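/- **Theorem (twisted Eilenberg–Zilber).** Let $F$ and $B$ be simplicial sets, $G$ a simplicial group acting (on the left, simplicially) on $F$, and let $\tau=(\tau_n\colon B_{n}\to G_{n-1})_{n>0}$ be a twisting function, i.e. $\partial_0\tau(b)=\tau(\partial_0b)^{-1}\tau(\partial_1b)$, $\partial_i\tau(b)=\tau(\partial_{i+1}b)$ for $i>0$, $\eta_i\tau(b)=\tau(\eta_{i+1}b)$ for $i\ge 0$, and $\tau(\eta_0b)=e$. Let $F\times_\tau B$ be the twisted product: it has the simplices, degeneracies and faces $\partial_i$, $i>0$, of $F\times B$, but $\partial_0(f,b)=(\tau(b)\cdot\partial_0f,\partial_0b)$. $C_*$ denotes normalized chains with integer coefficients, with the non-degenerate simplices as distinguished basis (cells); $F\times B$ and $F\times_\tau B$ have the same cells. *The Eilenberg–Zilber vector field.* A non-degenerate $n$-simplex of $F\times B$ is uniquely of the form $(\eta^*\phi,\theta^*\beta)$ with $\eta\colon[n]\to[p]$, $\theta\colon[n]\to[q]$ monotone surjections and $\phi\in F_p$, $\beta\in B_q$ non-degenerate; $(p,q)$ is its bidimension, and the points $(\eta(k),\theta(k))$, $0\le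 k\le n$, form a lattice path from $(0,0)$ to $(p,q)$ with steps $(1,0)$ (horizontal), $(0,1)$ (vertical) or $(1,1)$ (diagonal). Run the path backward from $(p,q)$. The simplex is called a *source* if the first event met is a diagonal step, a *target* if it is a bend consisting (in the forward direction) of a vertical step followed by a horizontal step, and *critical* if there is no such event. The vector field $V$ of $F\times B$ is the set of all pairs $(\partial_j\rho,\rho)$ where $\rho$ is a target, $j$ is the index of the vertex of its bend (so $j>0$), and the face is taken in $F\times B$. Then, on $C_*(F\times_\tau B)$: 1. The same collection of pairs $V$ is a discrete vector field: in each pair $(\sigma,\rho)$ the coefficient of $\sigma$ in $d\rho$ is $\pm1$, and every cell occurs at most once in $V$. A cell is the first component of a pair, the second component of a pair, or in no pair, according as it is a source, a target, or critical in the above sense. 2. $V$ is admissible: for every cell $\sigma$ there is a bound $\lambda(\sigma)\in\mathbb N$ for the lengths of the sequences $(\sigma_0,\rho_0),(\sigma_1,\rho_1),\dots$ of elements of $V$ with $\sigma_0=\sigma$ in which each $\sigma_{k+1}\ne\sigma_k$ has a non-zero coefficient in $d\rho_k$. Moreover the function $(q,p,L)$, compared lexicographically, is a Lyapunov function, i.e.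 it decreases strictly from each $\sigma_k$ to $\sigma_{k+1}$; here $(p,q)$ is the bidimension of the cell and $L$ the number of points of $\{0,\dots,p\}\times\{0,\dots,q\}$ strictly above its path. 3. Consequently $V$ defines a reduction $$TEZ=(f,g,h)\colon C_*(F\times_\tau B)\Rightarrow C_*(F)\otimes_tC_*(B),$$ that is, $f,g$ are chain maps, $h$ has degree $+1$, $fg=1$, $gf+dh+hd=1$, $fh=0$, $hg=0$, $hh=0$. The small complex has the same underlying graded module $\bigoplus_{p+q=n}C_p(F)\otimes C_q(B)$ as $C_*(F)\otimes C_*(B)$, with some differential $d_t$. This graded module is identified with the free module on the critical cells by sending $\phi\otimes\beta$, for non-degenerate $\phi\in F_p$, $\beta\in B_q$, to the critical cell of bidimension $(p,q)$ over $(\phi,\beta)$, whose path is $(0,0),\dots,(p,0),(p,1),\dots,(p,q)$. With respect to the decomposition of $C_*(F\times_\tau B)$ into target, source and critical parts (indices $1,2,3$), the component $d_{2,1}$ is an isomorphism and $$f=\begin{pmatrix}0&-d_{3,1}d_{2,1}^{-1}&1\end{pmatrix},\quad g=\begin{pmatrix}-d_{2,1}^{-1}d_{2,3}\\0\\1\end{pmatrix},\quad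 h=d_{2,1}^{-1}\text{ on the source part and }0\text{ on the other two},$$ so that $d_t=d_{3,3}-d_{3,1}d_{2,1}^{-1}d_{2,3}$. -/

import Mathlib

open CategoryTheory Simplicial Opposite MonoidalCategory

open scoped TensorProduct DirectSum

universe u w

noncomputable section

namespace TwistedEZ

/-! ### Algebraic cellular complexes -/

/-- A (non-negatively graded) algebraic cellular complex: the chain group in degree `n` is the
free `ℤ`-module on the distinguished basis `cell n`. -/
structure CellComplex where
  cell : ℕ → Type u
  bd : ∀ n, (cell (n + 1) →₀ ℤ) →ₗ[ℤ] (cell n →₀ ℤ)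
  bd_comp_bd : ∀ n, bd n ∘ₗ bd (n + 1) = 0

/-- The underlying chain complex of an algebraic cellular complex. -/
def CellComplex.chain (C : CellComplex.{u}) : ChainComplex (ModuleCat.{u} ℤ) ℕ :=
  ChainComplex.of (fun n => ModuleCat.of ℤ (C.cell n →₀ ℤ)) (fun n => ModuleCat.ofHom (C.bd n))
    (fun n => by rw [← ModuleCat.ofHom_comp, C.bd_comp_bd]; rfl)

section VectorFields

variable (C : CellComplex.{u})

/-- The coefficient of `s` in the boundary of `t`. -/
def incidence {n : ℕ} (s : C.cell n) (t : C.cell (n + 1)) : ℤ :=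
  C.bd n (Finsupp.single t 1) s

def IsFace {n : ℕ} (s : C.cell n) (t : C.cell (n + 1)) : Prop := incidence C s t ≠ 0

def IsRegularFace {n : ℕ} (s : C.cell n) (t : C.cell (n + 1)) : Prop :=
  incidence C s t = 1 ∨ incidence C s t = -1

/-- A collection of pairs `(s, t)` with `s` an `n`-cell and `t` an `(n + 1)`-cell. -/
abbrev PairFamily : Type u := ∀ n, C.cell n → C.cell (n + 1) → Prop

variable {C} (V : PairFamily C)

/-- A discrete vector field: in every vector the source is a regular face of the target, and
every cell occurs at most once in the whole collection. -/
structure IsDiscreteVectorField : Prop where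
  regular : ∀ {n} {s : C.cell n} {t : C.cell (n + 1)}, V n s t → IsRegularFace C s t
  target_unique : ∀ {n} {s : C.cell n} {t t' : C.cell (n + 1)}, V n s t → V n s t' → t = t'
  source_unique : ∀ {n} {s s' : C.cell n} {t : C.cell (n + 1)}, V n s t → V n s' t → s = s'
  not_source_of_target : ∀ {n} {s : C.cell n} {t : C.cell (n + 1)} {r : C.cell (n + 2)},
    V n s t → ¬ V (n + 1) t r

def IsSource {n : ℕ} (s : C.cell n) : Prop := ∃ t, V n s t

/-- The cell `t` is the second component of a vector. -/
def IsTarget {n : ℕ} (t : C.cell n) : Prop :=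
  match n, t with
  | 0, _ => False
  | m + 1, t => ∃ s : C.cell m, V m s t

def IsCritical {n : ℕ} (c : C.cell n) : Prop := ¬ IsSource V c ∧ ¬ IsTarget V c

/-- A `V`-path: a finite sequence of vectors in which the source of each vector but the first is
a face of the target of the previous vector, different from the source of that vector. -/
def IsVPath (n : ℕ) (l : List (C.cell n × C.cell (n + 1))) : Prop :=
  (∀ v ∈ l, V n v.1 v.2) ∧ l.IsChain (fun v v' => IsFace C v'.1 v.2 ∧ v'.1 ≠ v.1)

/-- The length of the `V`-paths starting from a given cell is bounded. -/
def IsAdmissible : Prop :=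
  ∃ bound : ∀ n, C.cell n → ℕ, ∀ n v l, IsVPath V n (v :: l) → (v :: l).length ≤ bound n v.1

/-- A Lyapunov function for `V` with values in an ordered set. -/
def IsLyapunov {α : Type*} [LT α] (L : ∀ n, C.cell n → α) : Prop :=
  ∀ n (s s' : C.cell n) (t t' : C.cell (n + 1)), V n s t → V n s' t' →
    IsFace C s' t → s' ≠ s → L n s' < L n s

/-- The chains whose support consists of cells with the property `P`. -/
def spanOf {n : ℕ} (P : C.cell n → Prop) : Submodule ℤ (C.cell n →₀ ℤ) :=
  Finsupp.supported ℤ ℤ {c | P c}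

/-- The component of a chain on the cells with the property `P`. -/
def component {n : ℕ} (P : C.cell n → Prop) : (C.cell n →₀ ℤ) →ₗ[ℤ] (C.cell n →₀ ℤ) := by
  classical exact Finsupp.linearCombination ℤ (fun c => if P c then Finsupp.single c 1 else 0)

end VectorFields

/-! ### Reductions -/

/-- A reduction `(f, g, h)` of a chain complex `C` onto a chain complex `D`: `f` and `g` are chain
maps, `h` has degree `+1`, `f g = 1`, `g f + d h + h d = 1`, `f h = 0`, `h g = 0`, `h h = 0`. -/
structure Reduction {R : Type*} [Ring R] (C D : ChainComplex (ModuleCat.{u} R) ℕ) where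
  f : C ⟶ D
  g : D ⟶ C
  h : Homotopy (𝟙 C) (f ≫ g)
  g_f : g ≫ f = 𝟙 D
  h_f : ∀ n, h.hom n (n + 1) ≫ f.f (n + 1) = 0
  g_h : ∀ n, g.f n ≫ h.hom n (n + 1) = 0
  h_h : ∀ n, h.hom n (n + 1) ≫ h.hom (n + 1) (n + 2) = 0

section

variable {C : CellComplex.{u}} {D : ChainComplex (ModuleCat.{u} ℤ) ℕ} (ρ : Reduction C.chain D)

/-- The component of `f` in degree `n`. -/
def Reduction.fMap (n : ℕ) : (C.cell n →₀ ℤ) →ₗ[ℤ] D.X n := (ρ.f.f n).hom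

/-- The component of `g` in degree `n`. -/
def Reduction.gMap (n : ℕ) : D.X n →ₗ[ℤ] (C.cell n →₀ ℤ) := (ρ.g.f n).hom

/-- The component of `h` from degree `n` to degree `n + 1`. -/
def Reduction.hMap (n : ℕ) : (C.cell n →₀ ℤ) →ₗ[ℤ] (C.cell (n + 1) →₀ ℤ) :=
  (ρ.h.hom n (n + 1)).hom

end

/-- The reduction `ρ` of the cellular complex `C` is the one which the vector field `V` defines by
Gauss elimination, where the graded module of the small complex `D` is identified by `κ` with the
free module on the critical cells. In block form, with respect to the decomposition of the chains
of `C` into target, source and critical components: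

* `h` vanishes on the target and critical components, and from source chains to target chains it
  is the inverse of the component `d₂₁` of `d` going from target chains to source chains;
* `f = [0, - d₃₁ d₂₁⁻¹, 1]`, that is, `f` is the critical component of `1 - d h`;
* `g = [- d₂₁⁻¹ d₂₃, 0, 1]ᵗ`, that is, `g` is the restriction of `1 - h d` to critical chains.

The differential of `D` is then forced to be `d₃₃ - d₃₁ d₂₁⁻¹ d₂₃`. -/
structure IsInducedBy {C : CellComplex.{u}} {D : ChainComplex (ModuleCat.{u} ℤ) ℕ}
    (ρ : Reduction C.chain D) (V : PairFamily C)
    (κ : ∀ n, D.X n ≃ₗ[ℤ] spanOf (fun c : C.cell n => IsCritical V c)) : Prop where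
  h_target : ∀ n (c : C.cell n), IsTarget V c →
    ρ.hMap n (Finsupp.single c 1) = 0
  h_critical : ∀ n (c : C.cell n), IsCritical V c →
    ρ.hMap n (Finsupp.single c 1) = 0
  h_source_mem : ∀ n (c : C.cell n), IsSource V c →
    ρ.hMap n (Finsupp.single c 1) ∈ spanOf (fun t : C.cell (n + 1) => IsTarget V t)
  d_h_source : ∀ n (c : C.cell n), IsSource V c →
    component (IsSource V) (C.bd n (ρ.hMap n (Finsupp.single c 1))) =
      Finsupp.single c 1
  h_d_target : ∀ n (c : C.cell (n + 1)), IsTarget V c →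
    ρ.hMap n (component (IsSource V) (C.bd n (Finsupp.single c 1))) =
      Finsupp.single c 1
  f_eq : ∀ n x, (κ n (ρ.fMap n x) : C.cell n →₀ ℤ) =
    component (IsCritical V) (x - C.bd n (ρ.hMap n x))
  g_zero : ∀ y, ρ.gMap 0 y = (κ 0 y : C.cell 0 →₀ ℤ)
  g_succ : ∀ n y, ρ.gMap (n + 1) y =
    (κ (n + 1) y : C.cell (n + 1) →₀ ℤ) - ρ.hMap n (C.bd n (κ (n + 1) y))

/-! ### The normalized chain complex of a simplicial set -/

section Normalized

variable (X : SSet.{u})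

/-- The class of a simplex in the normalized chains: the simplex itself if it is non-degenerate
and zero if it is degenerate. -/
def simplexChain {n : ℕ} (x : X _⦋n⦌) : X.nonDegenerate n →₀ ℤ := by
  classical exact if hx : x ∈ X.nonDegenerate n then Finsupp.single ⟨x, hx⟩ 1 else 0

/-- The alternating sum of the faces, where the degenerate faces are cancelled. -/
def normBd (n : ℕ) : (X.nonDegenerate (n + 1) →₀ ℤ) →ₗ[ℤ] (X.nonDegenerate n →₀ ℤ) :=
  Finsupp.linearCombination ℤ
    (fun x => ∑ i : Fin (n + 2), (-1 : ℤ) ^ (i : ℕ) • simplexChain X (X.δ i x.1))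

lemma simplexChain_of_degenerate {n : ℕ} {x : X _⦋n⦌} (hx : x ∈ X.degenerate n) :
    simplexChain X x = 0 := by
  classical
  unfold simplexChain
  rw [dif_neg]
  simpa [SSet.nonDegenerate] using hx

lemma simplexChain_of_nonDegenerate {n : ℕ} (x : X.nonDegenerate n) :
    simplexChain X x.1 = Finsupp.single x 1 := by
  classical
  unfold simplexChain
  rw [dif_pos x.2]

/-- The faces of a degenerate simplex cancel each other in the normalized chains. -/
lemma sum_faces_degenerate {n : ℕ} {x : X _⦋n + 1⦌} (hx : x ∈ X.degenerate (n + 1)) :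
    ∑ i : Fin (n + 2), (-1 : ℤ) ^ (i : ℕ) • simplexChain X (X.δ i x) = 0 := by
  rw [SSet.degenerate_eq_iUnion_range_σ, Set.mem_iUnion] at hx
  obtain ⟨j, y, rfl⟩ := hx
  have key : ∀ i : Fin (n + 2), i ≠ j.castSucc → i ≠ j.succ →
      simplexChain X (X.δ i (X.σ j y)) = 0 := by
    intro i h1 h2
    apply simplexChain_of_degenerate
    obtain _ | n := n
    · exfalso
      fin_cases j
      fin_cases i <;> simp at h1 h2
    rcases lt_or_gt_of_ne h1 with h | h
    · obtain ⟨j, rfl⟩ := Fin.exists_succ_eq.2 (show j ≠ 0 by rintro rfl; simp at h)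
      obtain ⟨i, rfl⟩ := Fin.exists_castSucc_eq.2 (show i ≠ Fin.last _ by
        rintro rfl; exact absurd h (by simp [Fin.lt_def]; omega))
      rw [SSet.δ_comp_σ_of_le_apply (by
        rw [Fin.lt_def] at h; rw [Fin.le_def]
        simp at h ⊢; omega)]
      apply SSet.σ_mem_degenerate
    · rw [SSet.δ_comp_σ_of_gt'_apply (by
        rw [Fin.lt_def] at h ⊢
        have := Fin.val_ne_of_ne h2
        simp at h this ⊢; omega)]
      apply SSet.σ_mem_degenerate
  rw [← Finset.sum_subset (Finset.subset_univ {j.castSucc, j.succ}) (by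
    intro i _ hi
    simp only [Finset.mem_insert, Finset.mem_singleton, not_or] at hi
    rw [key i hi.1 hi.2, smul_zero]), Finset.sum_pair (by simp [Fin.ext_iff])]
  rw [SSet.δ_comp_σ_self_apply, SSet.δ_comp_σ_succ_apply]
  simp [pow_succ]

lemma normBd_simplexChain {n : ℕ} (x : X _⦋n + 1⦌) :
    normBd X n (simplexChain X x) =
      ∑ i : Fin (n + 2), (-1 : ℤ) ^ (i : ℕ) • simplexChain X (X.δ i x) := by
  by_cases hx : x ∈ X.nonDegenerate (n + 1)
  · rw [simplexChain_of_nonDegenerate X ⟨x, hx⟩]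
    simp [normBd]
  · have hx' : x ∈ X.degenerate (n + 1) := by simpa [SSet.nonDegenerate] using hx
    rw [simplexChain_of_degenerate X hx', map_zero, sum_faces_degenerate X hx']

lemma sum_sum_faces {A : Type*} [AddCommGroup A] {n : ℕ} (φ : X _⦋n⦌ → A) (x : X _⦋n + 2⦌) :
    ∑ i : Fin (n + 3), ∑ j : Fin (n + 2),
      (-1 : ℤ) ^ ((i : ℕ) + (j : ℕ)) • φ (X.δ j (X.δ i x)) = 0 := by
  rw [← Finset.sum_product']
  refine Finset.sum_involution (fun p _ =>
    if h : p.2.castSucc < p.1 then (p.2.castSucc, p.1.pred (Fin.ne_zero_of_lt h))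
    else (p.2.succ, p.1.castPred (by
      rintro h'; rw [h'] at h; exact h (Fin.castSucc_lt_last _)))) ?_ ?_ ?_ ?_
  · rintro ⟨i, j⟩ -
    by_cases h : j.castSucc < i
    · obtain ⟨i, rfl⟩ := Fin.exists_succ_eq.2 (Fin.ne_zero_of_lt h)
      simp only [h, dif_pos, Fin.pred_succ]
      rw [SSet.δ_comp_δ_apply (show j ≤ i by simpa using h)]
      rw [← add_smul]
      simp only [Fin.val_succ, Fin.val_castSucc]
      rw [show (-1 : ℤ) ^ ((i : ℕ) + 1 + j) + (-1) ^ ((j : ℕ) + i) = 0 by ring, zero_smul]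
    · obtain ⟨i, rfl⟩ := Fin.exists_castSucc_eq.2 (show i ≠ Fin.last _ by
        rintro rfl; exact h (Fin.castSucc_lt_last _))
      simp only [h, dif_neg, not_false_eq_true, Fin.castPred_castSucc]
      rw [← SSet.δ_comp_δ_apply (i := i) (j := j) (by simpa using h)]
      rw [← add_smul]
      simp only [Fin.val_succ, Fin.val_castSucc]
      rw [show (-1 : ℤ) ^ ((i : ℕ) + j) + (-1) ^ ((j : ℕ) + 1 + i) = 0 by ring, zero_smul]
  · rintro ⟨i, j⟩ - -
    dsimp only
    split_ifs with h
    · exact fun h' => absurd (congrArg Prod.fst h') h.ne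
    · intro h'
      have := congrArg Prod.fst h'
      simp only at this
      exact h (by rw [← this]; exact Fin.castSucc_lt_succ)
  · intros; simp
  · rintro ⟨i, j⟩ -
    by_cases h : j.castSucc < i
    · have h2 : ¬ (i.pred (Fin.ne_zero_of_lt h)).castSucc < j.castSucc := by
        simp only [Fin.lt_def, Fin.val_castSucc, Fin.val_pred] at h ⊢; omega
      simp [h, h2]
    · have h3 : i ≠ Fin.last _ := by rintro rfl; exact h (Fin.castSucc_lt_last _)
      have h2 : (i.castPred h3).castSucc < j.succ := by
        simp only [Fin.lt_def, Fin.val_castSucc, Fin.val_succ, Fin.castSucc_castPred] at h ⊢; omega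
      simp only [h, dif_neg, not_false_eq_true]
      rw [dif_pos h2]
      simp

lemma normBd_comp_normBd (n : ℕ) : normBd X n ∘ₗ normBd X (n + 1) = 0 := by
  have h : ∀ x, normBd X n (normBd X (n + 1) (Finsupp.single x 1)) = 0 := by
    intro x
    rw [← simplexChain_of_nonDegenerate X x, normBd_simplexChain]
    simp only [map_sum, map_zsmul, normBd_simplexChain]
    simp only [Finset.smul_sum, smul_smul, ← pow_add]
    exact sum_sum_faces X _ x.1
  refine Finsupp.lhom_ext' fun x => LinearMap.ext_ring ?_
  simpa using h x

/-- The normalized chain complex of a simplicial set, with the non-degenerate simplices as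
cells. -/
def normalizedComplex : CellComplex.{u} where
  cell n := X.nonDegenerate n
  bd := normBd X
  bd_comp_bd := normBd_comp_normBd X

end Normalized

/-! ### Twisted products -/

/-- A (left) action of a simplicial group on a simplicial set. -/
structure SimplicialAction (G : SimplicialObject GrpCat.{w}) (F : SSet.{u}) where
  smul : ∀ {n : SimplexCategoryᵒᵖ}, G.obj n → F.obj n → F.obj n
  one_smul : ∀ {n : SimplexCategoryᵒᵖ} (x : F.obj n), smul 1 x = x
  mul_smul : ∀ {n : SimplexCategoryᵒᵖ} (g g' : G.obj n) (x : F.obj n),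
    smul (g * g') x = smul g (smul g' x)
  map_smul : ∀ {n m : SimplexCategoryᵒᵖ} (α : n ⟶ m) (g : G.obj n) (x : F.obj n),
    F.map α (smul g x) = smul (G.map α g) (F.map α x)

/-- A twisting function `τ` from a simplicial set to a simplicial group. -/
structure TwistingFunction (G : SimplicialObject GrpCat.{w}) (B : SSet.{u}) where
  τ : ∀ n : ℕ, B _⦋n + 1⦌ → G _⦋n⦌
  δ_zero : ∀ n (b : B _⦋n + 2⦌),
    G.δ 0 (τ (n + 1) b) = (τ n (B.δ 0 b))⁻¹ * τ n (B.δ 1 b)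
  δ_succ : ∀ n (b : B _⦋n + 2⦌) (i : Fin (n + 1)),
    G.δ i.succ (τ (n + 1) b) = τ n (B.δ i.succ.succ b)
  σ_succ : ∀ n (b : B _⦋n + 1⦌) (i : Fin (n + 1)),
    G.σ i (τ n b) = τ (n + 1) (B.σ i.succ b)
  σ_zero : ∀ n (b : B _⦋n⦌), τ n (B.σ 0 b) = 1

section TwistedProduct

/-- For `α : [m] ⟶ [n]`, the map `[m + 1] ⟶ [n]` with `0 ↦ 0` and `i + 1 ↦ α i`. -/
def hat {m n : ℕ} (α : ⦋m⦌ ⟶ ⦋n⦌) : ⦋m + 1⦌ ⟶ ⦋n⦌ :=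
  SimplexCategory.Hom.mk
    ⟨Fin.cons 0 (fun i => α.toOrderHom i), by
      intro i j hij
      induction i using Fin.cases with
      | zero => simp
      | succ i =>
        induction j using Fin.cases with
        | zero => simp at hij
        | succ j => simpa using α.toOrderHom.monotone (by simpa using hij)⟩

/-- For `α : [m] ⟶ [n]`, the map `[m + 1] ⟶ [n + 1]` with `0 ↦ 0` and `i + 1 ↦ α i + 1`. -/
def shift {m n : ℕ} (α : ⦋m⦌ ⟶ ⦋n⦌) : ⦋m + 1⦌ ⟶ ⦋n + 1⦌ := hat (α ≫ SimplexCategory.δ 0)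

@[simp] lemma hat_zero {m n : ℕ} (α : ⦋m⦌ ⟶ ⦋n⦌) : (hat α).toOrderHom 0 = 0 := rfl

@[simp] lemma hat_succ {m n : ℕ} (α : ⦋m⦌ ⟶ ⦋n⦌) (i : Fin (m + 1)) :
    (hat α).toOrderHom i.succ = α.toOrderHom i := rfl

@[simp] lemma shift_zero {m n : ℕ} (α : ⦋m⦌ ⟶ ⦋n⦌) : (shift α).toOrderHom 0 = 0 := rfl

@[simp] lemma shift_succ {m n : ℕ} (α : ⦋m⦌ ⟶ ⦋n⦌) (i : Fin (m + 1)) :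
    (shift α).toOrderHom i.succ = (α.toOrderHom i).succ := rfl

lemma hom_ext_cases {m n : ℕ} {α β : ⦋m + 1⦌ ⟶ ⦋n⦌}
    (h0 : α.toOrderHom 0 = β.toOrderHom 0)
    (hs : ∀ i : Fin (m + 1), α.toOrderHom i.succ = β.toOrderHom i.succ) : α = β := by
  apply SimplexCategory.Hom.ext
  ext i : 2
  induction i using Fin.cases with
  | zero => exact h0
  | succ i => exact hs i

lemma hat_comp {k m n : ℕ} (β : ⦋k⦌ ⟶ ⦋m⦌) (α : ⦋m⦌ ⟶ ⦋n⦌) :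
    hat (β ≫ α) = shift β ≫ hat α :=
  hom_ext_cases rfl fun _ => rfl

lemma shift_comp {k m n : ℕ} (β : ⦋k⦌ ⟶ ⦋m⦌) (α : ⦋m⦌ ⟶ ⦋n⦌) :
    shift (β ≫ α) = shift β ≫ shift α :=
  hom_ext_cases rfl fun _ => rfl

lemma δ_comp_hat {m n : ℕ} (α : ⦋m⦌ ⟶ ⦋n⦌) : SimplexCategory.δ 0 ≫ hat α = α := by
  apply SimplexCategory.Hom.ext
  ext i : 2
  change (hat α).toOrderHom (Fin.succAbove 0 i) = _
  rw [Fin.zero_succAbove, hat_succ]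

lemma δ_comp_shift {m n : ℕ} (α : ⦋m⦌ ⟶ ⦋n⦌) :
    SimplexCategory.δ 0 ≫ shift α = α ≫ SimplexCategory.δ 0 := rfl

lemma hat_of_zero {m n : ℕ} (α : ⦋m⦌ ⟶ ⦋n⦌) (h : α.toOrderHom 0 = 0) :
    hat α = SimplexCategory.σ 0 ≫ α :=
  hom_ext_cases h.symm fun _ => rfl

lemma hat_δ_zero (n : ℕ) : hat (SimplexCategory.δ (0 : Fin (n + 2))) = 𝟙 _ :=
  hom_ext_cases rfl fun _ => rfl

lemma shift_δ {n : ℕ} (i : Fin (n + 2)) :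
    shift (SimplexCategory.δ i) = SimplexCategory.δ i.succ :=
  hom_ext_cases (by simp [SimplexCategory.δ]) fun j => by
    simp [SimplexCategory.δ]

lemma shift_σ {n : ℕ} (i : Fin (n + 1)) :
    shift (SimplexCategory.σ i) = SimplexCategory.σ i.succ :=
  hom_ext_cases (by simp [SimplexCategory.σ]) fun j => by
    simp [SimplexCategory.σ]

variable {G : SimplicialObject GrpCat.{w}} {B F : SSet.{u}}

lemma TwistingFunction.τ_hat_of_zero (t : TwistingFunction G B) {m n : ℕ} (α : ⦋m⦌ ⟶ ⦋n⦌)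
    (h : α.toOrderHom 0 = 0) (b : B _⦋n⦌) : t.τ m (B.map (hat α).op b) = 1 := by
  rw [hat_of_zero α h, op_comp, Functor.map_comp_apply]
  exact t.σ_zero _ _

/-- The cocycle relation satisfied by a twisting function. -/
lemma TwistingFunction.cocycle (t : TwistingFunction G B) {k m : ℕ} (β : ⦋k⦌ ⟶ ⦋m⦌)
    (c : B _⦋m + 1⦌) :
    t.τ k (B.map (shift β).op c) =
      t.τ k (B.map (hat β).op (B.δ 0 c)) * G.map β.op (t.τ m c) := by
  let W : MorphismProperty SimplexCategory := fun x y f =>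
    ∀ c : B _⦋y.len + 1⦌, t.τ x.len (B.map (shift (m := x.len) (n := y.len) f).op c) =
      t.τ x.len (B.map (hat (m := x.len) (n := y.len) f).op (B.δ 0 c)) *
        G.map f.op (t.τ y.len c)
  have : W.IsMultiplicative :=
    { id_mem := fun x c => by
        have h1 : shift (𝟙 ⦋x.len⦌) = 𝟙 _ := hom_ext_cases rfl fun _ => rfl
        change t.τ x.len (B.map (shift (𝟙 ⦋x.len⦌)).op c) =
          t.τ x.len (B.map (hat (𝟙 ⦋x.len⦌)).op (B.δ 0 c)) * G.map (𝟙 (op ⦋x.len⦌)) (t.τ x.len c)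
        rw [h1, t.τ_hat_of_zero _ rfl]
        simp
      comp_mem := fun {x y z} f g hf hg c => by
        change t.τ x.len (B.map (shift (m := x.len) (n := z.len) (f ≫ g)).op c) =
          t.τ x.len (B.map (hat (m := x.len) (n := z.len) (f ≫ g)).op (B.δ 0 c)) *
          G.map (g.op ≫ f.op) (t.τ z.len c)
        have e1 : shift (m := x.len) (n := z.len) (f ≫ g) =
          shift (m := x.len) (n := y.len) f ≫ shift (m := y.len) (n := z.len) g := shift_comp _ _
        have e2 : hat (m := x.len) (n := z.len) (f ≫ g) =
          shift (m := x.len) (n := y.len) f ≫ hat (m := y.len) (n := z.len) g := hat_comp _ _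
        have e3 : B.δ 0 (B.map (shift (m := y.len) (n := z.len) g).op c) =
            B.map g.op (B.δ 0 c) := by
          change B.map _ (B.map _ _) = B.map _ (B.map _ _)
          rw [← Functor.map_comp_apply, ← Functor.map_comp_apply]
          rfl
        have e4 : B.δ 0 (B.map (hat (m := y.len) (n := z.len) g).op (B.δ 0 c)) =
            B.map g.op (B.δ 0 c) := by
          change B.map _ (B.map _ _) = B.map _ (B.map _ _)
          rw [← Functor.map_comp_apply, ← op_comp, δ_comp_hat]
          rfl
        rw [e1, e2, op_comp, op_comp, Functor.map_comp_apply, Functor.map_comp_apply, hf, hf, hg,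
          e3, e4, map_mul, mul_assoc, Functor.map_comp_apply] }
  have hW : W = ⊤ := by
    refine SimplexCategory.morphismProperty_eq_top W ?_ ?_
    · intro n i c
      change t.τ n (B.map (shift (SimplexCategory.δ i)).op c) =
        t.τ n (B.map (hat (SimplexCategory.δ i)).op (B.δ 0 c)) * G.δ i (t.τ (n + 1) c)
      induction i using Fin.cases with
      | zero =>
        rw [hat_δ_zero, shift_δ, t.δ_zero]
        simp
        rfl
      | succ i =>
        rw [t.τ_hat_of_zero _ rfl, shift_δ, t.δ_succ, one_mul]
        rfl
    · intro n i c
      change t.τ (n + 1) (B.map (shift (SimplexCategory.σ i)).op c) =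
        t.τ (n + 1) (B.map (hat (SimplexCategory.σ i)).op (B.δ 0 c)) * G.σ i (t.τ n c)
      rw [t.τ_hat_of_zero _ (by simp [SimplexCategory.σ]), shift_σ, t.σ_succ, one_mul]
      rfl
  have h : W β := by rw [hW]; trivial
  exact h c

lemma TwistingFunction.τ_hat_comp (t : TwistingFunction G B) {k m n : ℕ} (β : ⦋k⦌ ⟶ ⦋m⦌)
    (α : ⦋m⦌ ⟶ ⦋n⦌) (b : B _⦋n⦌) :
    t.τ k (B.map (hat (β ≫ α)).op b) =
      t.τ k (B.map (hat β).op (B.map α.op b)) * G.map β.op (t.τ m (B.map (hat α).op b)) := by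
  have e : B.δ 0 (B.map (hat α).op b) = B.map α.op b := by
    change B.map _ (B.map _ _) = _
    rw [← Functor.map_comp_apply, ← op_comp, δ_comp_hat]
  rw [hat_comp, op_comp, Functor.map_comp_apply, t.cocycle, e]

/-- The twisted product `F ×_τ B`. It is the simplicial set with the simplices of `F × B`, whose
face operators are `∂₀ (f, b) = (τ(b) • ∂₀ f, ∂₀ b)` and `∂ᵢ (f, b) = (∂ᵢ f, ∂ᵢ b)` for `i > 0`,
and whose degeneracy operators are `ηᵢ (f, b) = (ηᵢ f, ηᵢ b)`, see `twistedProduct_δ_zero`,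
`twistedProduct_δ_succ` and `twistedProduct_σ` below. The operator of an arbitrary `α` is
`α^* (f, b) = (τ((hat α)^* b) • α^* f, α^* b)`. -/
def twistedProduct (act : SimplicialAction G F) (t : TwistingFunction G B) : SSet.{u} where
  obj n := F.obj n × B.obj n
  map {n m} α := ↾fun p =>
    (act.smul (n := m) (t.τ m.unop.len (B.map (hat (m := m.unop.len) (n := n.unop.len) α.unop).op p.2)) (F.map α p.1),
      B.map α p.2)
  map_id n := by
    apply ConcreteCategory.hom_ext
    intro p
    refine Prod.ext ?_ ?_
    · change act.smul (t.τ n.unop.len (B.map (hat (𝟙 ⦋n.unop.len⦌)).op p.2)) (F.map (𝟙 n) p.1) = p.1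
      rw [t.τ_hat_of_zero _ rfl]
      exact (act.one_smul _).trans (by simp)
    · change B.map (𝟙 n) p.2 = p.2
      simp
  map_comp {n m k} α β := by
    apply ConcreteCategory.hom_ext
    intro p
    refine Prod.ext ?_ ?_
    · change act.smul (t.τ k.unop.len
          (B.map (hat (m := k.unop.len) (n := n.unop.len) (β.unop ≫ α.unop)).op p.2))
          (F.map (α ≫ β) p.1) =
        act.smul (t.τ k.unop.len
          (B.map (hat (m := k.unop.len) (n := m.unop.len) β.unop).op (B.map α p.2)))
          (F.map β (act.smul (t.τ m.unop.len
            (B.map (hat (m := m.unop.len) (n := n.unop.len) α.unop).op p.2)) (F.map α p.1)))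
      rw [act.map_smul, ← act.mul_smul, Functor.map_comp_apply]
      congr 1
      exact t.τ_hat_comp (k := k.unop.len) (m := m.unop.len) (n := n.unop.len) β.unop α.unop p.2
    · change B.map (α ≫ β) p.2 = B.map β (B.map α p.2)
      simp

variable (act : SimplicialAction G F) (t : TwistingFunction G B)

lemma twistedProduct_δ_zero {n : ℕ} (x : F _⦋n + 1⦌) (b : B _⦋n + 1⦌) :
    (twistedProduct act t).δ 0 (x, b) = (act.smul (t.τ n b) (F.δ 0 x), B.δ 0 b) := by
  change (act.smul (t.τ n (B.map (hat (SimplexCategory.δ 0)).op b)) (F.δ 0 x), B.δ 0 b) = _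
  rw [hat_δ_zero]
  simp

lemma twistedProduct_δ_succ {n : ℕ} (i : Fin (n + 1)) (x : F _⦋n + 1⦌) (b : B _⦋n + 1⦌) :
    (twistedProduct act t).δ i.succ (x, b) = (F.δ i.succ x, B.δ i.succ b) := by
  change (act.smul (t.τ n (B.map (hat (SimplexCategory.δ i.succ)).op b)) (F.δ i.succ x),
    B.δ i.succ b) = _
  rw [t.τ_hat_of_zero _ rfl, act.one_smul]

lemma twistedProduct_σ {n : ℕ} (i : Fin (n + 1)) (x : F _⦋n⦌) (b : B _⦋n⦌) :
    (twistedProduct act t).σ i (x, b) = (F.σ i x, B.σ i b) := by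
  change (act.smul (t.τ (n + 1) (B.map (hat (SimplexCategory.σ i)).op b)) (F.σ i x),
    B.σ i b) = _
  rw [t.τ_hat_of_zero _ (by simp [SimplexCategory.σ]), act.one_smul]

/-- The twisted and the untwisted product have the same non-degenerate simplices. -/
lemma mem_nonDegenerate_twistedProduct_iff {n : ℕ} (p : F _⦋n⦌ × B _⦋n⦌) :
    p ∈ (twistedProduct act t).nonDegenerate n ↔ p ∈ (F ⊗ B).nonDegenerate n := by
  obtain _ | n := n
  · rw [SSet.nondegenerate_zero, SSet.nondegenerate_zero]
    exact iff_of_true (Set.mem_univ _) (Set.mem_univ _)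
  · have key : (twistedProduct act t).degenerate (n + 1) = (F ⊗ B).degenerate (n + 1) := by
      rw [SSet.degenerate_eq_iUnion_range_σ, SSet.degenerate_eq_iUnion_range_σ]
      refine Set.iUnion_congr fun i => congrArg Set.range ?_
      exact funext fun y => twistedProduct_σ act t i y.1 y.2
    exact not_congr (iff_of_eq (congrArg (fun S : Set (F _⦋n + 1⦌ × B _⦋n + 1⦌) => p ∈ S) key))

end TwistedProduct

/-! ### Simplices of a product as s-paths -/

section SPaths

/-- The dimension `p` of the non-degenerate simplex in the canonical expression `x = η^* x'` of a
simplex, where `η` is a surjection `[n] ⟶ [p]` and `x'` is a non-degenerate `p`-simplex. -/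
def geomDim {X : SSet.{u}} {n : ℕ} (x : X _⦋n⦌) : ℕ := (X.exists_nonDegenerate x).choose

/-- The surjection `η : [n] ⟶ [p]` in the canonical expression `x = η^* x'` of a simplex. -/
def degMap {X : SSet.{u}} {n : ℕ} (x : X _⦋n⦌) : ⦋n⦌ ⟶ ⦋geomDim x⦌ :=
  (X.exists_nonDegenerate x).choose_spec.choose

variable {X Y : SSet.{u}}

/-- The bidimension of a simplex of `X × Y`. -/
def bidim {n : ℕ} (r : (X ⊗ Y : SSet.{u}) _⦋n⦌) : ℕ × ℕ := (geomDim r.1, geomDim r.2)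

/-- The s-path of a simplex `(η^* x', θ^* y')` of `X × Y`, in canonical form: the sequence of the
points `(η k, θ k)` of the lattice `[p] × [q]`, where `(p, q)` is the bidimension. -/
def sPath {n : ℕ} (r : (X ⊗ Y : SSet.{u}) _⦋n⦌) (k : Fin (n + 1)) : ℕ × ℕ :=
  ((degMap r.1).toOrderHom k, (degMap r.2).toOrderHom k)

variable {n : ℕ} (π : Fin (n + 1) → ℕ × ℕ)

def IsVertical (i : Fin n) : Prop := π i.succ = π i.castSucc + (0, 1)

def IsHorizontal (i : Fin n) : Prop := π i.succ = π i.castSucc + (1, 0)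

def IsDiagonal (i : Fin n) : Prop := π i.succ = π i.castSucc + (1, 1)

/-- The path has a `+90°` bend (when it is run backward) at the vertex `j = i + 1`: the step `i`
before this vertex is vertical and the step `j` after it is horizontal. -/
def IsBend (i j : Fin n) : Prop := (i : ℕ) + 1 = j ∧ IsVertical π i ∧ IsHorizontal π j

/-- When the path is run backward from its end to the vertex `k`, neither a diagonal step nor a
`+90°` bend is met. -/
def EventFreeFrom (k : ℕ) : Prop :=
  ∀ i : Fin n, k ≤ i → ¬ IsDiagonal π i ∧ ∀ j, ¬ IsBend π i j

/-- Run backward, the first event is a diagonal step. -/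
def IsSourcePath : Prop := ∃ i, IsDiagonal π i ∧ EventFreeFrom π (i + 1)

/-- Run backward, the first event is a `+90°` bend. -/
def IsTargetPath : Prop := ∃ i j, IsBend π i j ∧ EventFreeFrom π j

/-- No event occurs. -/
def IsCriticalPath : Prop := EventFreeFrom π 0

/-- The number of points of the lattice `[p] × [q]` strictly above the s-path of a simplex of
bidimension `(p, q)`. -/
def pointsAbove (r : (X ⊗ Y : SSet.{u}) _⦋n⦌) : ℕ := by
  classical exact
  ((Finset.range ((bidim r).1 + 1) ×ˢ Finset.range ((bidim r).2 + 1)).filter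
    (fun ab => ∀ k, (sPath r k).1 = ab.1 → (sPath r k).2 < ab.2)).card

end SPaths

/-! ### The Eilenberg-Zilber vector field -/

/-- The Eilenberg-Zilber vector field of `X × Y`: the pairs `(s, t)` of non-degenerate simplices
where the first event of `t` is a `+90°` bend and `s` is the face of `t` obtained by skipping the
vertex of this bend. -/
def ezField (X Y : SSet.{u}) : PairFamily (normalizedComplex (X ⊗ Y)) := fun n s t =>
  ∃ i j : Fin (n + 1), IsBend (sPath t.1) i j ∧ EventFreeFrom (sPath t.1) j ∧
    s.1 = (X ⊗ Y : SSet.{u}).δ j.castSucc t.1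

section

variable {G : SimplicialObject GrpCat.{w}} {F B : SSet.{u}}
  (act : SimplicialAction G F) (t : TwistingFunction G B)

/-- A non-degenerate simplex of `F ×_τ B`, seen as a non-degenerate simplex of `F × B`. -/
def untwist {n : ℕ} (c : (normalizedComplex (twistedProduct act t)).cell n) :
    (normalizedComplex (F ⊗ B)).cell n :=
  ⟨c.1, (mem_nonDegenerate_twistedProduct_iff act t c.1).1 c.2⟩

/-- The Eilenberg-Zilber vector field of `F × B`, seen as a collection of pairs of cells of
`F ×_τ B`. -/
def twistedEZField : PairFamily (normalizedComplex (twistedProduct act t)) := fun n s s' =>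
  ezField F B n (untwist act t s) (untwist act t s')

end

/-- The surjection `[p + q] ⟶ [p]`, `k ↦ min k p`. -/
def lastLeft (p q : ℕ) : ⦋p + q⦌ ⟶ ⦋p⦌ :=
  SimplexCategory.Hom.mk ⟨fun k => ⟨min k p, Nat.lt_succ_of_le (min_le_right _ _)⟩, fun i j h => by
    simp only [Fin.le_def] at h ⊢; omega⟩

/-- The surjection `[p + q] ⟶ [q]`, `k ↦ max 0 (k - p)`. -/
def lastRight (p q : ℕ) : ⦋p + q⦌ ⟶ ⦋q⦌ :=
  SimplexCategory.Hom.mk ⟨fun k => ⟨(k : ℕ) - p, by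
    have h : (k : ℕ) < p + q + 1 := k.isLt
    change (k : ℕ) - p < q + 1
    omega⟩, fun i j h => by
    simp only [Fin.le_def] at h ⊢; omega⟩

/-- The last simplex of the prism `x × y`, with the s-path
`(0, 0), (1, 0), …, (p, 0), (p, 1), …, (p, q)`. -/
def lastSimplex {X Y : SSet.{u}} {p q : ℕ} (x : X _⦋p⦌) (y : Y _⦋q⦌) :
    X _⦋p + q⦌ × Y _⦋p + q⦌ :=
  (X.map (lastLeft p q).op x, Y.map (lastRight p q).op y)

/-! ### The underlying graded module of the tensor product -/

section

variable (X Y : SSet.{u})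

/-- The component of degree `n` of the tensor product of the normalized chain complexes of `X` and
`Y`. -/
abbrev TensorModule (n : ℕ) : Type u :=
  ⨁ pq : Finset.HasAntidiagonal.antidiagonal n, (X.nonDegenerate pq.1.1 →₀ ℤ) ⊗[ℤ] (Y.nonDegenerate pq.1.2 →₀ ℤ)

/-- The generator `x ⊗ y`. -/
def tensorGen {X Y : SSet.{u}} {p q : ℕ} (x : X.nonDegenerate p) (y : Y.nonDegenerate q) :
    TensorModule X Y (p + q) :=
  DirectSum.lof ℤ (Finset.HasAntidiagonal.antidiagonal (p + q))
    (fun pq => (X.nonDegenerate pq.1.1 →₀ ℤ) ⊗[ℤ] (Y.nonDegenerate pq.1.2 →₀ ℤ))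
    ⟨(p, q), Finset.HasAntidiagonal.mem_antidiagonal.2 rfl⟩ (Finsupp.single x 1 ⊗ₜ[ℤ] Finsupp.single y 1)

/-- The chain complex with the same underlying graded module as the tensor product of the
normalized chain complexes of `X` and `Y`, and with the differential `d`. -/
abbrev twistedTensor (d : ∀ n, TensorModule X Y (n + 1) →ₗ[ℤ] TensorModule X Y n)
    (hd : ∀ n, d n ∘ₗ d (n + 1) = 0) : ChainComplex (ModuleCat.{u} ℤ) ℕ :=
  ChainComplex.of (fun n => ModuleCat.of ℤ (TensorModule X Y n)) (fun n => ModuleCat.ofHom (d n))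
    (fun n => by rw [← ModuleCat.ofHom_comp, hd]; rfl)

end

end TwistedEZ

end

open TwistedEZ

noncomputable section

namespace TwistedEZ

/-! ### Gauss elimination along an admissible vector field -/

section Gauss

variable {C : CellComplex.{u}}

/-! The proof has an algebraic half and a combinatorial half.

Algebra: if the steps between successive sources of `V`-paths form a well-founded relation, then the
block of `d` from targets to sources is triangular for this relation, with `±1` on the diagonal. It
is therefore invertible, and well-founded recursion gives its inverse `h`
(`component_source_bd_gaussMap`, `gaussMap_component_source_bd`). Block elimination then yields `f`
and `g`; the central identity is `g f = 1 - d h - h d` (`gaussIncl_gaussProj`).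

Combinatorics: a simplex of a product is governed by its lattice path. At a bend, the vertical step
repeats the first coordinate and the horizontal step repeats the second. Omitting the vertex of the
bend thus keeps the bidimension and leaves a diagonal step; conversely, a diagonal step can be split
into a bend (`bend_face`, `insertBend`). This matches targets with sources, and neither operation
sees the twist, because the vertex of a bend is never vertex `0`.

The twist can enter only through `∂₀`. If `∂₀` does not lower the dimension in the base, then `b =
η₀ ∂₀ b`, so `τ(b) = e` and the face is the untwisted one. Every genuinely twisted face therefore
has smaller `q` (`twistedProduct_δ_eq_or`), which is why `q` comes first in the Lyapunov function.
When the bidimension is kept, omitting the bend vertex of a target frees a lattice point above the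
path, whereas the other relevant omissions free none; so the count of points above the path
decreases strictly (`twistedEZField_isLyapunov`). Finally, a path without events runs first right,
then up, so critical cells correspond to pairs of non-degenerate simplices
(`criticalCell_bijective`). -/

lemma component_single_of_pos {n : ℕ} {P : C.cell n → Prop} {c : C.cell n} (h : P c) (a : ℤ) :
    component P (Finsupp.single c a) = Finsupp.single c a := by
  simp [component, h]

lemma component_single_of_neg {n : ℕ} {P : C.cell n → Prop} {c : C.cell n} (h : ¬ P c) (a : ℤ) :
    component P (Finsupp.single c a) = 0 := by
  simp [component, h]

lemma component_mem {n : ℕ} (P : C.cell n → Prop) (x : C.cell n →₀ ℤ) :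
    component P x ∈ spanOf P := by
  induction x using Finsupp.induction_linear with
  | zero => simp
  | add x y hx hy => rw [map_add]; exact add_mem hx hy
  | single c a =>
    by_cases h : P c
    · rw [component_single_of_pos h]
      exact Finsupp.single_mem_supported ℤ a h
    · rw [component_single_of_neg h]
      exact zero_mem _

lemma component_eq_sum {n : ℕ} (P : C.cell n → Prop) [DecidablePred P] (x : C.cell n →₀ ℤ) :
    component P x = ∑ c ∈ x.support, if P c then Finsupp.single c (x c) else 0 := by
  simp only [component, Finsupp.linearCombination_apply, Finsupp.sum]
  refine Finset.sum_congr rfl fun c _ => ?_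
  split_ifs <;> simp

lemma linearMap_eq_of_mem_spanOf {n : ℕ} {P : C.cell n → Prop} {M : Type*} [AddCommGroup M]
    [Module ℤ M] {φ ψ : (C.cell n →₀ ℤ) →ₗ[ℤ] M}
    (h : ∀ c, P c → φ (Finsupp.single c 1) = ψ (Finsupp.single c 1)) {x : C.cell n →₀ ℤ}
    (hx : x ∈ spanOf P) : φ x = ψ x := by
  rw [spanOf, Finsupp.supported_eq_span_single] at hx
  refine LinearMap.eqOn_span (s := (fun c => Finsupp.single c (1 : ℤ)) '' {c | P c}) ?_ hx
  rintro _ ⟨c, hc, rfl⟩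
  exact h c hc

lemma component_of_mem {n : ℕ} {P : C.cell n → Prop} {x : C.cell n →₀ ℤ} (hx : x ∈ spanOf P) :
    component P x = x :=
  linearMap_eq_of_mem_spanOf (φ := component P) (ψ := LinearMap.id)
    (fun _ hc => component_single_of_pos hc 1) hx

lemma component_of_mem_of_disjoint {n : ℕ} {P Q : C.cell n → Prop} (h : ∀ c, P c → ¬ Q c)
    {x : C.cell n →₀ ℤ} (hx : x ∈ spanOf P) : component Q x = 0 :=
  linearMap_eq_of_mem_spanOf (φ := component Q) (ψ := 0)
    (fun c hc => component_single_of_neg (h c hc) 1) hx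

variable {V : PairFamily C}

variable (V) in
/-- The step relation of `V`-paths, between the sources of two consecutive vectors. -/
def pathRel (n : ℕ) (s' s : C.cell n) : Prop :=
  ∃ t, V n s t ∧ IsFace C s' t ∧ s' ≠ s ∧ IsSource V s'

/-- Lyapunov functions compare only first components of vectors, which is why `pathRel` asks that
`s'` be a source. -/
lemma IsLyapunov.wellFounded_pathRel {α : Type*} [LT α] [WellFoundedLT α]
    {L : ∀ n, C.cell n → α} (hL : IsLyapunov V L) (n : ℕ) : WellFounded (pathRel V n) := by
  refine Subrelation.wf (r := InvImage (· < ·) (L n)) ?_ (InvImage.wf _ wellFounded_lt)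
  rintro s' s ⟨t, hst, hf, hne, t', hs't'⟩
  exact hL n s s' t t' hst hs't' hf hne

lemma finite_setOf_isFace {n : ℕ} (t : C.cell (n + 1)) : {s | IsFace C s t}.Finite :=
  (C.bd n (Finsupp.single t 1)).hasFiniteSupport

/-- The tree of paths from a cell is well-founded and finitely branching: a source has one vector,
whose target has finitely many faces. Hence the bound is one more than the maximum of the bounds for
these faces. -/
lemma IsDiscreteVectorField.isAdmissible (hV : IsDiscreteVectorField V)
    (hwf : ∀ n, WellFounded (pathRel V n)) : IsAdmissible V := by
  have key : ∀ n (s : C.cell n), ∃ N : ℕ, ∀ t l, IsVPath V n ((s, t) :: l) →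
      ((s, t) :: l).length ≤ N := by
    intro n s
    induction s using (hwf n).induction with
    | _ s ih =>
      by_cases hs : IsSource V s
      · obtain ⟨t, hst⟩ := hs
        choose! N hN using ih
        obtain ⟨M, hM⟩ := ((finite_setOf_isFace t).image N).bddAbove
        refine ⟨M + 1, fun t' l hl => ?_⟩
        obtain rfl : t = t' := hV.target_unique hst (hl.1 (s, t') (by simp))
        obtain _ | ⟨⟨s', t'⟩, l⟩ := l
        · simp
        · have hc := hl.2
          rw [List.isChain_cons_cons] at hc
          have hl' : IsVPath V n ((s', t') :: l) :=
            ⟨fun v hv => hl.1 v (List.mem_cons_of_mem _ hv), hc.2⟩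
          have hle := hN s' ⟨t, hst, hc.1.1, hc.1.2, t', hl.1 (s', t') (by simp)⟩ t' l hl'
          have : N s' ≤ M := hM (Set.mem_image_of_mem N hc.1.1)
          simp only [List.length_cons] at hle ⊢
          omega
      · exact ⟨0, fun t l hl => absurd ⟨t, hl.1 (s, t) (by simp)⟩ hs⟩
  choose N hN using key
  exact ⟨N, fun n v l hl => hN n v.1 v.2 l hl⟩

lemma IsDiscreteVectorField.not_isTarget_of_isSource (hV : IsDiscreteVectorField V) {n : ℕ}
    {c : C.cell n} (hs : IsSource V c) : ¬ IsTarget V c := by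
  obtain _ | n := n
  · exact fun h => h
  · rintro ⟨s, hs'⟩
    obtain ⟨t, ht⟩ := hs
    exact hV.not_source_of_target hs' ht

/-- The value on a cell of the homotopy operator defined by a vector field. -/
def gaussFun (hwf : ∀ n, WellFounded (pathRel V n)) (n : ℕ) : C.cell n → (C.cell (n + 1) →₀ ℤ) := by
  classical exact (hwf n).fix fun s ih =>
    if hs : IsSource V s then
      -- Write the source part of `d t` as `ε s + ∑ ε' s'`. Solving for `h s` gives `ε⁻¹ (t - ∑ ε' h
      -- s')`, and `ε⁻¹ = ε` for a sign.
      incidence C s hs.choose • (Finsupp.single hs.choose 1 -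
        ∑ s' ∈ (C.bd n (Finsupp.single hs.choose 1)).support,
          if hr : pathRel V n s' s then incidence C s' hs.choose • ih s' hr else 0)
    else 0

variable (hwf : ∀ n, WellFounded (pathRel V n))

open Classical in
-- Uniqueness of the target frees the recursion from the choice of `t`.
lemma gaussFun_source (hV : IsDiscreteVectorField V) {n : ℕ} {s : C.cell n} {t : C.cell (n + 1)}
    (h : V n s t) : gaussFun hwf n s = incidence C s t • (Finsupp.single t 1 -
        ∑ s' ∈ (C.bd n (Finsupp.single t 1)).support,
          if pathRel V n s' s then incidence C s' t • gaussFun hwf n s' else 0) := by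
  have hs : IsSource V s := ⟨t, h⟩
  obtain rfl : t = hs.choose := hV.target_unique h hs.choose_spec
  rw [gaussFun, WellFounded.fix_eq, dif_pos hs]
  rfl

lemma gaussFun_of_not_source {n : ℕ} {s : C.cell n} (h : ¬ IsSource V s) :
    gaussFun hwf n s = 0 := by
  rw [gaussFun, WellFounded.fix_eq, dif_neg h]

/-- The homotopy operator defined by a vector field: the inverse of the component of the
differential from target chains to source chains. -/
def gaussMap (n : ℕ) : (C.cell n →₀ ℤ) →ₗ[ℤ] (C.cell (n + 1) →₀ ℤ) :=
  Finsupp.linearCombination ℤ (gaussFun hwf n)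

lemma gaussMap_single {n : ℕ} (c : C.cell n) (a : ℤ) :
    gaussMap hwf n (Finsupp.single c a) = a • gaussFun hwf n c := by
  simp [gaussMap]

lemma gaussMap_of_not_source {n : ℕ} {c : C.cell n} (h : ¬ IsSource V c) (a : ℤ) :
    gaussMap hwf n (Finsupp.single c a) = 0 := by
  rw [gaussMap_single, gaussFun_of_not_source hwf h, smul_zero]

variable (hV : IsDiscreteVectorField V)

include hV

lemma IsDiscreteVectorField.incidence_mul_self {n : ℕ} {s : C.cell n} {t : C.cell (n + 1)}
    (h : V n s t) : incidence C s t * incidence C s t = 1 := by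
  rcases hV.regular h with h | h <;> rw [h] <;> rfl

open Classical in
/-- The source component of the boundary of the target of a vector. -/
lemma component_source_bd {n : ℕ} {s : C.cell n} {t : C.cell (n + 1)} (h : V n s t) :
    component (IsSource V) (C.bd n (Finsupp.single t 1)) =
      Finsupp.single s (incidence C s t) +
        ∑ s' ∈ (C.bd n (Finsupp.single t 1)).support,
          if pathRel V n s' s then Finsupp.single s' (incidence C s' t) else 0 := by
  have hne : incidence C s t ≠ 0 := fun h0 => by simpa [h0] using hV.incidence_mul_self h
  have hmem : s ∈ (C.bd n (Finsupp.single t 1)).support := Finsupp.mem_support_iff.2 hne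
  rw [component_eq_sum, ← Finset.add_sum_erase _ _ hmem,
    ← Finset.add_sum_erase _ (fun s' => if pathRel V n s' s then _ else _) hmem,
    if_pos ⟨t, h⟩, if_neg (fun hr : pathRel V n s s => hr.choose_spec.2.2.1 rfl), zero_add]
  congr 1
  refine Finset.sum_congr rfl fun s' hs' => ?_
  rw [Finset.mem_erase, Finsupp.mem_support_iff] at hs'
  refine if_congr ⟨fun hsrc => ⟨t, h, hs'.2, hs'.1, hsrc⟩, fun hr => hr.choose_spec.2.2.2⟩ rfl rfl

lemma gaussMap_mem {n : ℕ} (x : C.cell n →₀ ℤ) :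
    gaussMap hwf n x ∈ spanOf (fun t : C.cell (n + 1) => IsTarget V t) := by
  classical
  have key : ∀ s : C.cell n, gaussFun hwf n s ∈ spanOf (fun t : C.cell (n + 1) => IsTarget V t) := by
    intro s
    induction s using (hwf n).induction with
    | _ s ih =>
      by_cases hs : IsSource V s
      · obtain ⟨t, h⟩ := hs
        rw [gaussFun_source hwf hV h]
        refine Submodule.smul_mem _ _ (sub_mem ?_ (sum_mem fun s' _ => ?_))
        · exact Finsupp.single_mem_supported ℤ 1 (show IsTarget V t from ⟨s, h⟩)
        · split_ifs with hr
          · exact Submodule.smul_mem _ _ (ih s' hr)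
          · exact zero_mem _
      · rw [gaussFun_of_not_source hwf hs]
        exact zero_mem _
  rw [gaussMap, Finsupp.linearCombination_apply]
  exact sum_mem fun s _ => Submodule.smul_mem _ _ (key s)

/-- By induction along `pathRel`, the corrections in the recursion cancel precisely the source faces
of `t` other than `s`. -/
lemma component_source_bd_gaussMap {n : ℕ} {s : C.cell n} (hs : IsSource V s) :
    component (IsSource V) (C.bd n (gaussMap hwf n (Finsupp.single s 1))) =
      Finsupp.single s 1 := by
  classical
  rw [gaussMap_single, one_smul]
  induction s using (hwf n).induction with
  | _ s ih =>
    obtain ⟨t, h⟩ := hs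
    rw [gaussFun_source hwf hV h, map_smul, map_smul, map_sub, map_sub, map_sum, map_sum,
      component_source_bd hV h]
    have : ∀ s' ∈ (C.bd n (Finsupp.single t 1)).support,
        component (IsSource V) (C.bd n
          (if pathRel V n s' s then incidence C s' t • gaussFun hwf n s' else 0)) =
        if pathRel V n s' s then Finsupp.single s' (incidence C s' t) else 0 := by
      intro s' _
      split_ifs with hr
      · rw [map_smul, map_smul, ih s' hr hr.choose_spec.2.2.2]
        simp
      · simp
    rw [Finset.sum_congr rfl this, add_sub_cancel_right, Finsupp.smul_single, smul_eq_mul,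
      hV.incidence_mul_self h]

/-- No induction is needed: the terms `h s'` subtracted in the recursion formula for `h s` are those
contributed by the other source faces. -/
lemma gaussMap_component_source_bd {n : ℕ} {t : C.cell (n + 1)} (ht : IsTarget V t) :
    gaussMap hwf n (component (IsSource V) (C.bd n (Finsupp.single t 1))) =
      Finsupp.single t 1 := by
  classical
  obtain ⟨s, h⟩ := ht
  rw [component_source_bd hV h, map_add, map_sum, gaussMap_single, gaussFun_source hwf hV h,
    smul_smul, hV.incidence_mul_self h, one_smul]
  have : ∀ s' ∈ (C.bd n (Finsupp.single t 1)).support,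
      gaussMap hwf n (if pathRel V n s' s then Finsupp.single s' (incidence C s' t) else 0) =
        if pathRel V n s' s then incidence C s' t • gaussFun hwf n s' else 0 := by
    intro s' _
    split_ifs
    · rw [gaussMap_single]
    · simp
  rw [Finset.sum_congr rfl this, sub_add_cancel]

omit hV in
lemma gaussMap_component_source {n : ℕ} (x : C.cell n →₀ ℤ) :
    gaussMap hwf n (component (IsSource V) x) = gaussMap hwf n x := by
  induction x using Finsupp.induction_linear with
  | zero => simp
  | add x y hx hy => simp only [map_add, hx, hy]
  | single c a =>
    by_cases h : IsSource V c
    · rw [component_single_of_pos h]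
    · rw [component_single_of_neg h, gaussMap_of_not_source hwf h, map_zero]

omit hV in
lemma gaussMap_of_disjoint {n : ℕ} {P : C.cell n → Prop} (hP : ∀ c, P c → ¬ IsSource V c)
    {x : C.cell n →₀ ℤ} (hx : x ∈ spanOf P) : gaussMap hwf n x = 0 := by
  rw [← gaussMap_component_source, component_of_mem_of_disjoint hP hx, map_zero]

lemma gaussMap_bd_of_target {n : ℕ} {x : C.cell (n + 1) →₀ ℤ}
    (hx : x ∈ spanOf (fun t : C.cell (n + 1) => IsTarget V t)) :
    gaussMap hwf n (C.bd n x) = x :=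
  linearMap_eq_of_mem_spanOf (φ := gaussMap hwf n ∘ₗ C.bd n) (ψ := LinearMap.id)
    (fun t ht => by
      change gaussMap hwf n (C.bd n _) = Finsupp.single t 1
      rw [← gaussMap_component_source, gaussMap_component_source_bd hwf hV ht]) hx

lemma gaussMap_gaussMap {n : ℕ} (x : C.cell n →₀ ℤ) :
    gaussMap hwf (n + 1) (gaussMap hwf n x) = 0 :=
  gaussMap_of_disjoint hwf (fun _ ht hs => hV.not_isTarget_of_isSource hs ht)
    (gaussMap_mem hwf hV x)

lemma component_critical_gaussMap {n : ℕ} (x : C.cell n →₀ ℤ) :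
    component (fun c : C.cell (n + 1) => IsCritical V c) (gaussMap hwf n x) = 0 :=
  component_of_mem_of_disjoint (fun _ ht hc => hc.2 ht) (gaussMap_mem hwf hV x)

lemma component_source_bd_gaussMap' {n : ℕ} (x : C.cell n →₀ ℤ) :
    component (IsSource V) (C.bd n (gaussMap hwf n x)) = component (IsSource V) x := by
  rw [← gaussMap_component_source]
  exact linearMap_eq_of_mem_spanOf
    (φ := component (IsSource V) ∘ₗ C.bd n ∘ₗ gaussMap hwf n) (ψ := LinearMap.id)
    (fun s hs => component_source_bd_gaussMap hwf hV hs) (component_mem _ x)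

lemma component_add_component_add_component {n : ℕ} (x : C.cell n →₀ ℤ) :
    component (IsTarget V) x + component (IsSource V) x +
      component (IsCritical V) x = x := by
  induction x using Finsupp.induction_linear with
  | zero => simp
  | add x y hx hy =>
    conv_rhs => rw [← hx, ← hy]
    simp only [map_add]
    abel
  | single c a =>
    by_cases hs : IsSource V c
    · rw [component_single_of_pos hs, component_single_of_neg (hV.not_isTarget_of_isSource hs),
        component_single_of_neg (fun h : IsCritical V c => h.1 hs)]
      simp
    · by_cases ht : IsTarget V c
      · rw [component_single_of_pos ht, component_single_of_neg hs,
          component_single_of_neg (fun h : IsCritical V c => h.2 ht)]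
        simp
      · rw [component_single_of_neg ht, component_single_of_neg hs,
          component_single_of_pos (show IsCritical V c from ⟨hs, ht⟩)]
        simp

end Gauss

/-! ### The reduction obtained by Gauss elimination -/

section GaussReduction

variable {C : CellComplex.{u}} {V : PairFamily C} (hV : IsDiscreteVectorField V)
  (hwf : ∀ n, WellFounded (pathRel V n))

/-- The endomorphism `h d` of the chains of degree `n`. -/
def gaussMapBd (n : ℕ) : (C.cell n →₀ ℤ) →ₗ[ℤ] (C.cell n →₀ ℤ) :=
  match n with
  | 0 => 0
  | n + 1 => gaussMap hwf n ∘ₗ C.bd n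

lemma gaussMap_gaussMapBd (hV : IsDiscreteVectorField V) (n : ℕ) (x : C.cell n →₀ ℤ) :
    gaussMap hwf n (gaussMapBd hwf n x) = 0 := by
  obtain _ | n := n
  · simp [gaussMapBd]
  · exact gaussMap_gaussMap hwf hV _

lemma component_critical_gaussMapBd (hV : IsDiscreteVectorField V) (n : ℕ) (x : C.cell n →₀ ℤ) :
    component (fun c : C.cell n => IsCritical V c) (gaussMapBd hwf n x) = 0 := by
  obtain _ | n := n
  · simp [gaussMapBd]
  · exact component_critical_gaussMap hwf hV _

lemma gaussMapBd_of_target (hV : IsDiscreteVectorField V) (n : ℕ) {x : C.cell n →₀ ℤ}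
    (hx : x ∈ spanOf (fun t : C.cell n => IsTarget V t)) : gaussMapBd hwf n x = x := by
  obtain _ | n := n
  -- No cell of degree `0` is a target, so the support of `x` is empty.
  · have : x = 0 := by
      ext c
      by_contra hc
      exact hx (Finsupp.mem_support_iff.2 hc)
    simp [this]
  · exact gaussMap_bd_of_target hwf hV hx

lemma CellComplex.bd_bd (n : ℕ) (x : C.cell (n + 2) →₀ ℤ) : C.bd n (C.bd (n + 1) x) = 0 :=
  LinearMap.congr_fun (C.bd_comp_bd n) x

lemma gaussMapBd_bd (n : ℕ) (x : C.cell (n + 1) →₀ ℤ) :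
    gaussMapBd hwf n (C.bd n x) = 0 := by
  obtain _ | n := n
  · rfl
  · change gaussMap hwf n (C.bd n (C.bd (n + 1) x)) = 0
    rw [C.bd_bd, map_zero]

variable {M : ℕ → Type u} [∀ n, AddCommGroup (M n)] [∀ n, Module ℤ (M n)]
  (κ : ∀ n, M n ≃ₗ[ℤ] spanOf (fun c : C.cell n => IsCritical V c))

/-- The projection of the reduction defined by a vector field. -/
def gaussProj (n : ℕ) : (C.cell n →₀ ℤ) →ₗ[ℤ] M n :=
  (κ n).symm.toLinearMap ∘ₗ
    ((component (fun c : C.cell n => IsCritical V c) ∘ₗ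
      (LinearMap.id - C.bd n ∘ₗ gaussMap hwf n)).codRestrict
        (spanOf (fun c : C.cell n => IsCritical V c)) fun x => by
          exact component_mem _ (x - C.bd n (gaussMap hwf n x)))

/-- The injection of the reduction defined by a vector field. -/
def gaussIncl (n : ℕ) : M n →ₗ[ℤ] (C.cell n →₀ ℤ) :=
  (LinearMap.id - gaussMapBd hwf n) ∘ₗ Submodule.subtype _ ∘ₗ (κ n).toLinearMap

/-- The differential of the critical complex. -/
def gaussBd (n : ℕ) : M (n + 1) →ₗ[ℤ] M n :=
  gaussProj hwf κ n ∘ₗ C.bd n ∘ₗ gaussIncl hwf κ (n + 1)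

lemma coe_gaussProj (n : ℕ) (x : C.cell n →₀ ℤ) :
    (κ n (gaussProj hwf κ n x) : C.cell n →₀ ℤ) =
      component (fun c : C.cell n => IsCritical V c) (x - C.bd n (gaussMap hwf n x)) := by
  simp [gaussProj]

lemma gaussIncl_apply (n : ℕ) (y : M n) :
    gaussIncl hwf κ n y = (κ n y : C.cell n →₀ ℤ) - gaussMapBd hwf n (κ n y) := rfl

lemma gaussMap_critical {n : ℕ} {x : C.cell n →₀ ℤ}
    (hx : x ∈ spanOf (fun c : C.cell n => IsCritical V c)) : gaussMap hwf n x = 0 :=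
  gaussMap_of_disjoint hwf (fun _ hc => hc.1) hx

section

include hV

lemma gaussMap_gaussIncl (n : ℕ) (y : M n) : gaussMap hwf n (gaussIncl hwf κ n y) = 0 := by
  rw [gaussIncl_apply, map_sub, gaussMap_gaussMapBd hwf hV, gaussMap_critical hwf (κ n y).2,
    sub_zero]

lemma gaussProj_gaussIncl (n : ℕ) (y : M n) : gaussProj hwf κ n (gaussIncl hwf κ n y) = y := by
  apply (κ n).injective
  apply Subtype.ext
  rw [coe_gaussProj, gaussMap_gaussIncl hV hwf κ, map_zero, sub_zero, gaussIncl_apply, map_sub,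
    component_critical_gaussMapBd hwf hV, component_of_mem (κ n y).2, sub_zero]

lemma gaussProj_gaussMap (n : ℕ) (x : C.cell n →₀ ℤ) :
    gaussProj hwf κ (n + 1) (gaussMap hwf n x) = 0 := by
  apply (κ (n + 1)).injective
  apply Subtype.ext
  rw [coe_gaussProj, gaussMap_gaussMap hwf hV, map_zero, sub_zero,
    component_critical_gaussMap hwf hV]
  simp

/-- The chain `y = x - d h x` has no source part, since `d₂₁ h = 1` on sources. Its critical part is
thus `y` minus its target part. On target chains `h d` is the identity, so `1 - h d` kills the
target part, and `h d y = h d x` because `d d = 0`. -/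
lemma gaussIncl_gaussProj (n : ℕ) (x : C.cell n →₀ ℤ) :
    gaussIncl hwf κ n (gaussProj hwf κ n x) =
      x - C.bd n (gaussMap hwf n x) - gaussMapBd hwf n x := by
  rw [gaussIncl_apply, coe_gaussProj]
  set y := x - C.bd n (gaussMap hwf n x) with hy
  have h1 := component_add_component_add_component hV y
  have h2 : component (IsSource V) y = 0 := by
    rw [hy, map_sub, component_source_bd_gaussMap' hwf hV, sub_self]
  rw [h2, add_zero] at h1
  have h3 : component (IsCritical V) y = y - component (IsTarget V) y := by
    rw [eq_sub_iff_add_eq, add_comm, h1]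
  have h4 : gaussMapBd hwf n y = gaussMapBd hwf n x := by
    rw [hy, map_sub, gaussMapBd_bd, sub_zero]
  clear_value y
  change component (IsCritical V) y - gaussMapBd hwf n (component (IsCritical V) y) = _
  rw [h3, map_sub, gaussMapBd_of_target hwf hV n (component_mem (IsTarget V) y), h4]
  abel

lemma eq_gaussMapBd_add (n : ℕ) (x : C.cell n →₀ ℤ) :
    x = gaussMapBd hwf n x + C.bd n (gaussMap hwf n x) +
      gaussIncl hwf κ n (gaussProj hwf κ n x) := by
  rw [gaussIncl_gaussProj hV]
  abel

/-- Applying `d` to `g f = 1 - d h - h d`, evaluated at `g y`, gives `d h d g y = 0`; hence `g f`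
fixes `d g y`. -/
lemma gaussIncl_gaussBd (n : ℕ) (y : M (n + 1)) :
    gaussIncl hwf κ n (gaussBd hwf κ n y) = C.bd n (gaussIncl hwf κ (n + 1) y) := by
  change gaussIncl hwf κ n (gaussProj hwf κ n (C.bd n (gaussIncl hwf κ (n + 1) y))) = _
  have e : C.bd n (gaussMap hwf n (C.bd n (gaussIncl hwf κ (n + 1) y))) = 0 := by
    have h1 := congrArg (C.bd n) (gaussIncl_gaussProj hV hwf κ (n + 1) (gaussIncl hwf κ (n + 1) y))
    rw [gaussProj_gaussIncl hV, map_sub, map_sub, C.bd_bd, sub_zero] at h1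
    exact sub_eq_self.1 h1.symm
  rw [gaussIncl_gaussProj hV, gaussMapBd_bd, e, sub_zero, sub_zero]

/-- From `d d = 0`, both `d g f x` and `g f d x` equal `d x - d h d x`; apply `f` and use `f g = 1`.
-/
lemma gaussBd_gaussProj (n : ℕ) (x : C.cell (n + 1) →₀ ℤ) :
    gaussBd hwf κ n (gaussProj hwf κ (n + 1) x) = gaussProj hwf κ n (C.bd n x) := by
  change gaussProj hwf κ n (C.bd n (gaussIncl hwf κ (n + 1) (gaussProj hwf κ (n + 1) x))) = _
  rw [gaussIncl_gaussProj hV, map_sub (C.bd n), map_sub (C.bd n), C.bd_bd, sub_zero]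
  have h := gaussIncl_gaussProj hV hwf κ n (C.bd n x)
  rw [gaussMapBd_bd, sub_zero] at h
  change gaussProj hwf κ n (C.bd n x - C.bd n (gaussMap hwf n (C.bd n x))) = _
  rw [← h, gaussProj_gaussIncl hV]

lemma gaussBd_comp_gaussBd (n : ℕ) : gaussBd hwf κ n ∘ₗ gaussBd hwf κ (n + 1) = 0 := by
  ext y
  change gaussProj hwf κ n (C.bd n (gaussIncl hwf κ (n + 1) (gaussBd hwf κ (n + 1) y))) = 0
  rw [gaussIncl_gaussBd hV, C.bd_bd, map_zero]

end

/-- The chain complex with the modules `M n` and the differential `d`. -/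
abbrev complexOf (M : ℕ → Type u) [∀ n, AddCommGroup (M n)] [∀ n, Module ℤ (M n)]
    (d : ∀ n, M (n + 1) →ₗ[ℤ] M n) (hd : ∀ n, d n ∘ₗ d (n + 1) = 0) :
    ChainComplex (ModuleCat.{u} ℤ) ℕ :=
  ChainComplex.of (fun n => ModuleCat.of ℤ (M n)) (fun n => ModuleCat.ofHom (d n))
    (fun n => by rw [← ModuleCat.ofHom_comp, hd]; rfl)

lemma complexOf_d (d : ∀ n, M (n + 1) →ₗ[ℤ] M n) (hd : ∀ n, d n ∘ₗ d (n + 1) = 0) (n : ℕ) :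
    (complexOf M d hd).d (n + 1) n = ModuleCat.ofHom (d n) :=
  ChainComplex.of_d (fun n => ModuleCat.of ℤ (M n)) (fun n => ModuleCat.ofHom (d n)) n

lemma CellComplex.chain_d (n : ℕ) : C.chain.d (n + 1) n = ModuleCat.ofHom (C.bd n) :=
  ChainComplex.of_d (fun n => ModuleCat.of ℤ (C.cell n →₀ ℤ)) (fun n => ModuleCat.ofHom (C.bd n)) n

/-- The operator `h` in all pairs of degrees. -/
def gaussHom (i j : ℕ) : C.chain.X i ⟶ C.chain.X j :=
  if h : i + 1 = j then
    ModuleCat.ofHom (gaussMap hwf i) ≫ eqToHom (congrArg C.chain.X h)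
  else 0

lemma gaussHom_succ (n : ℕ) : gaussHom hwf n (n + 1) = ModuleCat.ofHom (gaussMap hwf n) := by
  rw [gaussHom, dif_pos rfl]
  exact Category.comp_id _

/-- The reduction defined by a vector field. -/
def gaussReduction : Reduction C.chain
    (complexOf M (gaussBd hwf κ) (gaussBd_comp_gaussBd hV hwf κ)) where
  f :=
    { f := fun n => ModuleCat.ofHom (gaussProj hwf κ n)
      comm' := by
        rintro _ n rfl
        rw [complexOf_d, C.chain_d]
        ext x
        exact gaussBd_gaussProj hV hwf κ n _ }
  g :=
    { f := fun n => ModuleCat.ofHom (gaussIncl hwf κ n)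
      comm' := by
        rintro _ n rfl
        rw [complexOf_d, C.chain_d]
        ext x
        exact (gaussIncl_gaussBd hV hwf κ n _).symm }
  h :=
    { hom := gaussHom hwf
      zero := fun i j hij => dif_neg hij
      comm := fun n => by
        have h1 : prevD n (gaussHom hwf) = ModuleCat.ofHom (C.bd n ∘ₗ gaussMap hwf n) := by
          rw [prevD_eq _ (show (ComplexShape.down ℕ).Rel (n + 1) n from rfl), gaussHom_succ,
            C.chain_d]
          rfl
        have h2 : dNext n (gaussHom hwf) = ModuleCat.ofHom (gaussMapBd hwf n) := by
          obtain _ | n := n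
          · rw [dNext_eq_zero _ _ (by simp)]
            rfl
          · rw [dNext_eq _ (show (ComplexShape.down ℕ).Rel (n + 1) n from rfl), gaussHom_succ,
              C.chain_d]
            rfl
        rw [h1, h2]
        apply ModuleCat.hom_ext
        exact LinearMap.ext fun x => eq_gaussMapBd_add hV hwf κ n x }
  g_f := by
    ext n : 1
    apply ModuleCat.hom_ext
    exact LinearMap.ext fun y => gaussProj_gaussIncl hV hwf κ n y
  h_f n := by
    change gaussHom hwf n (n + 1) ≫ _ = 0
    rw [gaussHom_succ]
    apply ModuleCat.hom_ext
    exact LinearMap.ext fun y => gaussProj_gaussMap hV hwf κ n y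
  g_h n := by
    change _ ≫ gaussHom hwf n (n + 1) = 0
    rw [gaussHom_succ]
    apply ModuleCat.hom_ext
    exact LinearMap.ext fun y => gaussMap_gaussIncl hV hwf κ n y
  h_h n := by
    change gaussHom hwf n (n + 1) ≫ gaussHom hwf (n + 1) (n + 2) = 0
    rw [gaussHom_succ, gaussHom_succ]
    apply ModuleCat.hom_ext
    exact LinearMap.ext fun y => gaussMap_gaussMap hwf hV y

lemma gaussReduction_hMap (n : ℕ) : (gaussReduction hV hwf κ).hMap n = gaussMap hwf n :=
  congrArg ModuleCat.Hom.hom (gaussHom_succ hwf n)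

lemma gaussReduction_isInducedBy : IsInducedBy (gaussReduction hV hwf κ) V κ where
  h_target n c hc := by
    rw [gaussReduction_hMap]
    exact gaussMap_of_not_source hwf (fun hs => hV.not_isTarget_of_isSource hs hc) 1
  h_critical n c hc := by
    rw [gaussReduction_hMap]
    exact gaussMap_of_not_source hwf hc.1 1
  h_source_mem n c _ := by
    rw [gaussReduction_hMap]
    exact gaussMap_mem hwf hV _
  d_h_source n c hc := by
    rw [gaussReduction_hMap]
    exact component_source_bd_gaussMap hwf hV hc
  h_d_target n c hc := by
    rw [gaussReduction_hMap]
    exact gaussMap_component_source_bd hwf hV hc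
  f_eq n x := by
    rw [gaussReduction_hMap]
    exact coe_gaussProj hwf κ n x
  g_zero y := sub_zero _
  g_succ n y := by
    rw [gaussReduction_hMap]
    rfl

include hV hwf in
/-- A vector field without infinite paths defines a reduction onto any graded module identified with
the free module on the critical cells. -/
lemma exists_reduction_isInducedBy : ∃ (d : ∀ n, M (n + 1) →ₗ[ℤ] M n)
    (hd : ∀ n, d n ∘ₗ d (n + 1) = 0) (ρ : Reduction C.chain (complexOf M d hd)),
    IsInducedBy ρ V κ :=
  ⟨_, _, _, gaussReduction_isInducedBy hV hwf κ⟩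

end GaussReduction

/-! ### The canonical expression of a simplex -/

section Canonical

variable {X : SSet.{u}} {n m : ℕ}

instance (x : X _⦋n⦌) : Epi (degMap x) :=
  (X.exists_nonDegenerate x).choose_spec.choose_spec.choose

/-- The non-degenerate simplex in the canonical expression of a simplex. -/
def degCore (x : X _⦋n⦌) : X.nonDegenerate (geomDim x) :=
  (X.exists_nonDegenerate x).choose_spec.choose_spec.choose_spec.choose

lemma map_degMap (x : X _⦋n⦌) : X.map (degMap x).op (degCore x).1 = x :=
  (X.exists_nonDegenerate x).choose_spec.choose_spec.choose_spec.choose_spec.symm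

/-- The values of the surjection in the canonical expression of a simplex. -/
def degVal (x : X _⦋n⦌) (k : Fin (n + 1)) : ℕ := ((degMap x).toOrderHom k : ℕ)

/-- Uniqueness of the canonical expression makes the choices harmless: any expression of this kind
computes them. -/
lemma geomDim_eq {p : ℕ} (x : X _⦋n⦌) (f : ⦋n⦌ ⟶ ⦋p⦌) [Epi f] (y : X.nonDegenerate p)
    (h : x = X.map f.op y.1) : geomDim x = p :=
  X.unique_nonDegenerate_dim x (degMap x) (degCore x) (map_degMap x).symm f y h

lemma degVal_eq {p : ℕ} (x : X _⦋n⦌) (f : ⦋n⦌ ⟶ ⦋p⦌) [Epi f] (y : X.nonDegenerate p)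
    (h : x = X.map f.op y.1) (k : Fin (n + 1)) : degVal x k = f.toOrderHom k := by
  obtain rfl := geomDim_eq x f y h
  rw [degVal, X.unique_nonDegenerate_map x (degMap x) (degCore x) (map_degMap x).symm f y h]

lemma degMap_surjective (x : X _⦋n⦌) : Function.Surjective (degMap x).toOrderHom :=
  SimplexCategory.epi_iff_surjective.1 inferInstance

lemma degVal_le (x : X _⦋n⦌) (k : Fin (n + 1)) : degVal x k ≤ geomDim x :=
  Nat.le_of_lt_succ ((degMap x).toOrderHom k).isLt

lemma degVal_mono (x : X _⦋n⦌) : Monotone (degVal x) :=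
  fun _ _ h => (degMap x).toOrderHom.monotone h

lemma exists_degVal_eq (x : X _⦋n⦌) {a : ℕ} (ha : a ≤ geomDim x) : ∃ k, degVal x k = a := by
  obtain ⟨k, hk⟩ := degMap_surjective x ⟨a, Nat.lt_succ_of_le ha⟩
  exact ⟨k, congrArg Fin.val hk⟩

lemma degVal_zero (x : X _⦋n⦌) : degVal x 0 = 0 := by
  obtain ⟨k, hk⟩ := exists_degVal_eq x (Nat.zero_le _)
  have := degVal_mono x (Fin.zero_le k)
  omega

lemma degVal_last (x : X _⦋n⦌) : degVal x (Fin.last n) = geomDim x := by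
  obtain ⟨k, hk⟩ := exists_degVal_eq x le_rfl
  exact le_antisymm (degVal_le x _) (hk ▸ degVal_mono x (Fin.le_last k))

lemma degVal_step (x : X _⦋n⦌) (i : Fin n) :
    degVal x i.succ = degVal x i.castSucc ∨ degVal x i.succ = degVal x i.castSucc + 1 := by
  have h1 := degVal_mono x (Fin.castSucc_lt_succ (i := i)).le
  by_contra! h
  obtain ⟨k, hk⟩ := exists_degVal_eq x (a := degVal x i.castSucc + 1) (by
    have := degVal_le x i.succ; omega)
  rcases lt_or_ge k i.succ with hki | hki
  · have := degVal_mono x (show k ≤ i.castSucc from Nat.lt_succ_iff.1 hki)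
    omega
  · have := degVal_mono x hki
    omega

lemma map_eq_map_degCore (x : X _⦋n⦌) (f : ⦋m⦌ ⟶ ⦋n⦌) :
    X.map f.op x = X.map (f ≫ degMap x).op (degCore x).1 := by
  conv_lhs => rw [← map_degMap x]
  rw [op_comp, Functor.map_comp_apply]

lemma geomDim_map (x : X _⦋n⦌) (f : ⦋m⦌ ⟶ ⦋n⦌)
    (h : Function.Surjective fun k => (degMap x).toOrderHom (f.toOrderHom k)) :
    geomDim (X.map f.op x) = geomDim x := by
  have : Epi (f ≫ degMap x) := SimplexCategory.epi_iff_surjective.2 h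
  exact geomDim_eq _ (f ≫ degMap x) (degCore x) (map_eq_map_degCore x f)

lemma degVal_map (x : X _⦋n⦌) (f : ⦋m⦌ ⟶ ⦋n⦌)
    (h : Function.Surjective fun k => (degMap x).toOrderHom (f.toOrderHom k)) (k : Fin (m + 1)) :
    degVal (X.map f.op x) k = degVal x (f.toOrderHom k) := by
  have : Epi (f ≫ degMap x) := SimplexCategory.epi_iff_surjective.2 h
  exact degVal_eq _ (f ≫ degMap x) (degCore x) (map_eq_map_degCore x f) k

/-- A section of the surjection exhibits the non-degenerate core as the image of `x` under an
operator into `[n]`. Such an operator must be mono, as its value is non-degenerate. -/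
lemma geomDim_map_le (x : X _⦋n⦌) (f : ⦋m⦌ ⟶ ⦋n⦌) : geomDim (X.map f.op x) ≤ n := by
  set y := X.map f.op x
  have hsplit := isSplitEpi_of_epi (degMap y)
  have h : X.map (section_ (degMap y) ≫ f).op x = (degCore y).1 := by
    rw [op_comp, Functor.map_comp_apply]
    change X.map (section_ (degMap y)).op y = _
    rw [map_eq_map_degCore y, IsSplitEpi.id]
    simp
  have := X.mono_of_nonDegenerate (degCore y) (section_ (degMap y) ≫ f) x h
  exact SimplexCategory.len_le_of_mono (section_ (degMap y) ≫ f)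

/-- The composite with the canonical surjection factors through a proper face of the core, and
`geomDim_map_le` applies to that face. -/
lemma geomDim_map_lt (x : X _⦋n⦌) (f : ⦋m⦌ ⟶ ⦋n⦌)
    (h : ¬ Function.Surjective fun k => (degMap x).toOrderHom (f.toOrderHom k)) :
    geomDim (X.map f.op x) < geomDim x := by
  rw [map_eq_map_degCore]
  generalize hg : f ≫ degMap x = g
  have hg' : ¬ Epi g := by
    rw [SimplexCategory.epi_iff_surjective, ← hg]
    exact h
  have h1 : X.map g.op (degCore x).1 =
      X.map (Limits.factorThruImage g).op (X.map (Limits.image.ι g).op (degCore x).1) := by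
    rw [← Functor.map_comp_apply, ← op_comp, Limits.image.fac]
  have h2 : (Limits.image g).len < geomDim x := by
    refine lt_of_le_of_ne (SimplexCategory.len_le_of_mono (Limits.image.ι g)) fun he => hg' ?_
    have : IsIso (Limits.image.ι g) := (SimplexCategory.isIso_iff_of_mono _).2 he
    rw [← Limits.image.fac g]
    infer_instance
  rw [h1]
  exact lt_of_le_of_lt (geomDim_map_le (n := (Limits.image g).len) _ _) h2

lemma σ_toOrderHom_surjective (i : Fin (n + 1)) :
    Function.Surjective (SimplexCategory.σ i).toOrderHom :=
  SimplexCategory.epi_iff_surjective.1 inferInstance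

lemma degVal_σ (x : X _⦋n⦌) (i : Fin (n + 1)) (k : Fin (n + 2)) :
    degVal (X.σ i x) k = degVal x (i.predAbove k) :=
  degVal_map x (SimplexCategory.σ i) ((degMap_surjective x).comp (σ_toOrderHom_surjective i)) k

/-- Either another vertex has the same value as `k`, and the canonical expression of the `k`-th face
is obtained by skipping `k`, or the geometric dimension drops. -/
lemma degVal_δ (x : X _⦋n + 1⦌) (k : Fin (n + 2)) :
    ((∃ k', k' ≠ k ∧ degVal x k' = degVal x k) ∧ geomDim (X.δ k x) = geomDim x ∧
      ∀ i, degVal (X.δ k x) i = degVal x (k.succAbove i)) ∨ geomDim (X.δ k x) < geomDim x := by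
  by_cases h : Function.Surjective
      fun i => (degMap x).toOrderHom ((SimplexCategory.δ k).toOrderHom i)
  · refine Or.inl ⟨?_, geomDim_map x _ h, degVal_map x _ h⟩
    obtain ⟨i, hi⟩ := h ((degMap x).toOrderHom k)
    exact ⟨k.succAbove i, Fin.succAbove_ne k i, congrArg Fin.val hi⟩
  · exact Or.inr (geomDim_map_lt x _ h)

lemma degVal_δ_of_eq (x : X _⦋n + 1⦌) {k k' : Fin (n + 2)} (hne : k' ≠ k)
    (h : degVal x k' = degVal x k) : geomDim (X.δ k x) = geomDim x ∧
      ∀ i, degVal (X.δ k x) i = degVal x (k.succAbove i) := by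
  have hs : Function.Surjective
      fun i => (degMap x).toOrderHom ((SimplexCategory.δ k).toOrderHom i) := by
    intro a
    obtain ⟨l, rfl⟩ := degMap_surjective x a
    by_cases hl : l = k
    · obtain ⟨i, rfl⟩ := Fin.exists_succAbove_eq hne
      exact ⟨i, Fin.ext (hl ▸ h)⟩
    · obtain ⟨i, rfl⟩ := Fin.exists_succAbove_eq hl
      exact ⟨i, rfl⟩
  exact ⟨geomDim_map x _ hs, degVal_map x _ hs⟩

/-- The operator `σ i` followed by `δ k` at most interchanges the roles of two adjacent vertices
with equal value, so the canonical surjection absorbs it. -/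
lemma σ_δ_eq_self (x : X _⦋n + 1⦌) (i : Fin (n + 1)) (k : Fin (n + 2))
    (hk : k = i.castSucc ∨ k = i.succ) (h : degVal x i.succ = degVal x i.castSucc) :
    X.σ i (X.δ k x) = x := by
  have e : SimplexCategory.σ i ≫ SimplexCategory.δ k ≫ degMap x = degMap x := by
    apply SimplexCategory.Hom.ext
    ext l : 2
    apply Fin.ext
    change degVal x (k.succAbove (i.predAbove l)) = degVal x l
    rcases lt_trichotomy l i.castSucc with hl | rfl | hl
    · congr 1
      rw [Fin.predAbove_of_le_castSucc _ _ hl.le]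
      rw [Fin.succAbove_of_castSucc_lt]
      · simp
      · rw [Fin.castSucc_castPred]
        rcases hk with rfl | rfl
        · exact hl
        · exact hl.trans Fin.castSucc_lt_succ
    · rw [Fin.predAbove_castSucc_self]
      rcases hk with rfl | rfl
      · rw [Fin.succAbove_castSucc_self, h]
      · rw [Fin.succAbove_succ_self]
    · rw [Fin.predAbove_of_castSucc_lt _ _ hl]
      rcases eq_or_lt_of_le (show i.succ ≤ l from hl) with rfl | hl'
      · rw [Fin.pred_succ]
        rcases hk with rfl | rfl
        · rw [Fin.succAbove_castSucc_self]
        · rw [Fin.succAbove_succ_self, h]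
      · congr 1
        rw [Fin.succAbove_of_lt_succ, Fin.succ_pred]
        rw [Fin.succ_pred]
        rcases hk with rfl | rfl
        · exact hl
        · exact hl'
  change X.map (SimplexCategory.σ i).op (X.map (SimplexCategory.δ k).op x) = x
  rw [← Functor.map_comp_apply, ← op_comp, map_eq_map_degCore, Category.assoc, e, map_degMap]

end Canonical

/-! ### The paths of the non-degenerate simplices of a product -/

section Product

variable {X Y : SSet.{u}} {n : ℕ}

lemma sPath_eq (r : (X ⊗ Y : SSet.{u}) _⦋n⦌) (k : Fin (n + 1)) :
    sPath r k = (degVal r.1 k, degVal r.2 k) := rfl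

/-- A pair lies in the image of `σ i` exactly when both coordinates are stationary at step `i`. -/
lemma mem_nonDegenerate_prod_iff (r : (X ⊗ Y : SSet.{u}) _⦋n⦌) :
    r ∈ (X ⊗ Y : SSet.{u}).nonDegenerate n ↔
      ∀ i : Fin n, sPath r i.succ ≠ sPath r i.castSucc := by
  obtain _ | n := n
  · exact ⟨fun _ i => i.elim0, fun _ => by rw [SSet.nondegenerate_zero]; exact Set.mem_univ _⟩
  · rw [SSet.mem_nonDegenerate_iff_notMem_degenerate, SSet.degenerate_eq_iUnion_range_σ,
      Set.mem_iUnion, not_exists]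
    refine forall_congr' fun i => not_congr ⟨?_, fun h => ?_⟩
    · rintro ⟨y, rfl⟩
      change (degVal (X.σ i y.1) _, degVal (Y.σ i y.2) _) =
        (degVal (X.σ i y.1) _, degVal (Y.σ i y.2) _)
      simp [degVal_σ]
    · rw [sPath_eq, sPath_eq, Prod.mk.injEq] at h
      exact ⟨(X ⊗ Y : SSet.{u}).δ i.succ r, Prod.ext (σ_δ_eq_self r.1 i _ (.inr rfl) h.1)
        (σ_δ_eq_self r.2 i _ (.inr rfl) h.2)⟩

end Product

/-! ### Events on lattice paths -/

section Paths

variable {n : ℕ} {π : Fin (n + 1) → ℕ × ℕ}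

lemma isVertical_iff (i : Fin n) : IsVertical π i ↔
    (π i.succ).1 = (π i.castSucc).1 ∧ (π i.succ).2 = (π i.castSucc).2 + 1 := by
  simp [IsVertical, Prod.ext_iff]

lemma isHorizontal_iff (i : Fin n) : IsHorizontal π i ↔
    (π i.succ).1 = (π i.castSucc).1 + 1 ∧ (π i.succ).2 = (π i.castSucc).2 := by
  simp [IsHorizontal, Prod.ext_iff]

lemma isDiagonal_iff (i : Fin n) : IsDiagonal π i ↔
    (π i.succ).1 = (π i.castSucc).1 + 1 ∧ (π i.succ).2 = (π i.castSucc).2 + 1 := by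
  simp [IsDiagonal, Prod.ext_iff]

lemma IsVertical.not_isDiagonal {i : Fin n} (h : IsVertical π i) : ¬ IsDiagonal π i := by
  rw [isVertical_iff] at h
  rw [isDiagonal_iff]
  omega

lemma IsHorizontal.not_isDiagonal {i : Fin n} (h : IsHorizontal π i) : ¬ IsDiagonal π i := by
  rw [isHorizontal_iff] at h
  rw [isDiagonal_iff]
  omega

lemma IsHorizontal.not_isVertical {i : Fin n} (h : IsHorizontal π i) : ¬ IsVertical π i := by
  rw [isHorizontal_iff] at h
  rw [isVertical_iff]
  omega

lemma EventFreeFrom.mono {k l : ℕ} (h : EventFreeFrom π k) (hkl : k ≤ l) : EventFreeFrom π l :=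
  fun i hi => h i (hkl.trans hi)

lemma IsSourcePath.not_isTargetPath (hs : IsSourcePath π) : ¬ IsTargetPath π := by
  rintro ⟨i', j', hb, hf'⟩
  obtain ⟨i, hd, hf⟩ := hs
  have hj := hb.1
  by_cases h1 : (j' : ℕ) ≤ i
  · exact (hf' i h1).1 hd
  · by_cases h2 : (i : ℕ) = i'
    · obtain rfl := Fin.ext h2
      exact hb.2.1.not_isDiagonal hd
    · exact (hf i' (by omega)).2 j' hb

lemma isSourcePath_or_isTargetPath_or_isCriticalPath (π : Fin (n + 1) → ℕ × ℕ) :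
    IsSourcePath π ∨ IsTargetPath π ∨ IsCriticalPath π := by
  by_cases h : ∃ i, IsDiagonal π i ∨ ∃ j, IsBend π i j
  · classical
    -- Running backward, the first event met has the largest index.
    obtain ⟨i, hi, hmax⟩ := Finset.exists_max_image
      (Finset.univ.filter fun i => IsDiagonal π i ∨ ∃ j, IsBend π i j) id
      (h.imp fun i hi => by simpa using hi)
    rw [Finset.mem_filter] at hi
    have hf : EventFreeFrom π (i + 1) := by
      intro k hk
      rw [← not_exists, ← not_or]
      intro hk'
      have : k ≤ i := hmax k (by simpa using hk')
      rw [Fin.le_def] at this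
      omega
    rcases hi.2 with hd | ⟨j, hb⟩
    · exact Or.inl ⟨i, hd, hf⟩
    · exact Or.inr (Or.inl ⟨i, j, hb, hb.1 ▸ hf⟩)
  · push Not at h
    exact Or.inr (Or.inr fun i _ => h i)

lemma isCriticalPath_iff : IsCriticalPath π ↔ ¬ IsSourcePath π ∧ ¬ IsTargetPath π := by
  refine ⟨fun h => ⟨?_, ?_⟩, fun h => ?_⟩
  · rintro ⟨i, hd, -⟩
    exact (h i (Nat.zero_le _)).1 hd
  · rintro ⟨i, j, hb, -⟩
    exact (h i (Nat.zero_le _)).2 j hb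
  · rcases isSourcePath_or_isTargetPath_or_isCriticalPath π with h' | h' | h'
    · exact absurd h' h.1
    · exact absurd h' h.2
    · exact h'

lemma first_diagonal_unique {i i' : Fin n} (hd : IsDiagonal π i) (hf : EventFreeFrom π (i + 1))
    (hd' : IsDiagonal π i') (hf' : EventFreeFrom π (i' + 1)) : i = i' := by
  apply Fin.ext
  by_contra hne
  rcases Nat.lt_or_gt_of_ne hne with h | h
  · exact (hf i' h).1 hd'
  · exact (hf' i h).1 hd

lemma first_bend_unique {i j i' j' : Fin n} (hb : IsBend π i j) (hf : EventFreeFrom π j)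
    (hb' : IsBend π i' j') (hf' : EventFreeFrom π j') : j = j' := by
  apply Fin.ext
  have h1 := hb.1
  have h2 := hb'.1
  by_contra hne
  rcases Nat.lt_or_gt_of_ne hne with h | h
  · exact (hf i' (by omega)).2 j' hb'
  · exact (hf' i (by omega)).2 j hb

end Paths

/-! ### Omitting one vertex of a path -/

section Skip

variable {n : ℕ} {π : Fin (n + 2) → ℕ × ℕ} {π' : Fin (n + 1) → ℕ × ℕ} {k : Fin (n + 2)}
  (hπ : ∀ l, π' l = π (k.succAbove l))

include hπ

lemma skip_castSucc {i : Fin n} (hi : (k : ℕ) ≤ i) : π' i.castSucc = π i.succ.castSucc := by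
  rw [hπ, Fin.succAbove_of_le_castSucc _ _ (by rw [Fin.le_def]; simpa using hi)]
  rfl

lemma skip_succ {i : Fin n} (hi : (k : ℕ) ≤ i) : π' i.succ = π i.succ.succ := by
  rw [hπ, Fin.succAbove_of_le_castSucc _ _ (by rw [Fin.le_def]; simp; omega)]

lemma isDiagonal_skip {i : Fin n} (hi : (k : ℕ) ≤ i) : IsDiagonal π' i ↔ IsDiagonal π i.succ := by
  rw [IsDiagonal, IsDiagonal, skip_castSucc hπ hi, skip_succ hπ hi]

lemma isVertical_skip {i : Fin n} (hi : (k : ℕ) ≤ i) : IsVertical π' i ↔ IsVertical π i.succ := by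
  rw [IsVertical, IsVertical, skip_castSucc hπ hi, skip_succ hπ hi]

lemma isHorizontal_skip {i : Fin n} (hi : (k : ℕ) ≤ i) :
    IsHorizontal π' i ↔ IsHorizontal π i.succ := by
  rw [IsHorizontal, IsHorizontal, skip_castSucc hπ hi, skip_succ hπ hi]

lemma isBend_skip {i j : Fin n} (hi : (k : ℕ) ≤ i) : IsBend π' i j ↔ IsBend π i.succ j.succ := by
  simp only [IsBend, Fin.val_succ, Nat.add_right_cancel_iff]
  refine and_congr_right fun h => ?_
  rw [isVertical_skip hπ hi, isHorizontal_skip hπ (by omega)]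

lemma eventFreeFrom_skip {m : ℕ} (hk : (k : ℕ) ≤ m) :
    EventFreeFrom π' m ↔ EventFreeFrom π (m + 1) := by
  refine ⟨fun h i hi => ?_, fun h i hi => ?_⟩
  · obtain ⟨i, rfl⟩ := Fin.exists_succ_eq.2 (show i ≠ 0 by rintro rfl; simp at hi)
    simp only [Fin.val_succ, Nat.add_le_add_iff_right] at hi
    rw [← isDiagonal_skip hπ (hk.trans hi)]
    refine ⟨(h i hi).1, fun j hb => ?_⟩
    obtain ⟨j, rfl⟩ := Fin.exists_succ_eq.2 (show j ≠ 0 by rintro rfl; simpa using hb.1)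
    exact (h i hi).2 j ((isBend_skip hπ (hk.trans hi)).2 hb)
  · rw [isDiagonal_skip hπ (hk.trans hi)]
    have := h i.succ (by simpa using hi)
    exact ⟨this.1, fun j hb => this.2 j.succ ((isBend_skip hπ (hk.trans hi)).1 hb)⟩

/-- Skipping a vertex before the last bend does not change the first event. -/
lemma isTargetPath_skip {i j : Fin (n + 1)} (hb : IsBend π i j) (hf : EventFreeFrom π j)
    (hk : (k : ℕ) < i) : IsTargetPath π' := by
  have hij := hb.1
  obtain ⟨i, rfl⟩ := Fin.exists_succ_eq.2 (show i ≠ 0 by rintro rfl; simp at hk)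
  obtain ⟨j, rfl⟩ := Fin.exists_succ_eq.2 (show j ≠ 0 by rintro rfl; simp at hij)
  simp only [Fin.val_succ] at hij hk hf
  exact ⟨i, j, (isBend_skip hπ (by omega)).2 hb, (eventFreeFrom_skip hπ (by omega)).2 hf⟩

end Skip

/-! ### Bends and diagonals: the pairing of targets with sources -/

section EZField

variable {X Y : SSet.{u}} {n : ℕ}

lemma sPath_fst_mono (r : (X ⊗ Y : SSet.{u}) _⦋n⦌) : Monotone fun k => (sPath r k).1 :=
  degVal_mono r.1

lemma sPath_snd_mono (r : (X ⊗ Y : SSet.{u}) _⦋n⦌) : Monotone fun k => (sPath r k).2 :=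
  degVal_mono r.2

lemma isStep_of_nonDegenerate {r : (X ⊗ Y : SSet.{u}) _⦋n⦌}
    (hr : r ∈ (X ⊗ Y : SSet.{u}).nonDegenerate n) (i : Fin n) :
    IsVertical (sPath r) i ∨ IsHorizontal (sPath r) i ∨ IsDiagonal (sPath r) i := by
  have h0 := (mem_nonDegenerate_prod_iff r).1 hr i
  rw [isVertical_iff, isHorizontal_iff, isDiagonal_iff]
  have h1 := degVal_step r.1 i
  have h2 := degVal_step r.2 i
  simp only [sPath_eq, ne_eq, Prod.mk.injEq] at h0 ⊢
  omega

/-- The sum of the coordinates increases at every step. -/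
lemma sPath_injective {r : (X ⊗ Y : SSet.{u}) _⦋n⦌}
    (hr : r ∈ (X ⊗ Y : SSet.{u}).nonDegenerate n) : Function.Injective (sPath r) := by
  have h : StrictMono fun k => (sPath r k).1 + (sPath r k).2 := by
    rw [Fin.strictMono_iff_lt_succ]
    intro i
    have := isStep_of_nonDegenerate hr i
    rw [isVertical_iff, isHorizontal_iff, isDiagonal_iff] at this
    omega
  intro k l hkl
  exact h.injective (by simp [hkl])

/-- The face of a simplex obtained by skipping the vertex of a bend. -/
lemma bend_face {r : (X ⊗ Y : SSet.{u}) _⦋n + 1⦌} {i j : Fin (n + 1)}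
    (hb : IsBend (sPath r) i j) :
    bidim ((X ⊗ Y : SSet.{u}).δ j.castSucc r) = bidim r ∧
      ∀ l, sPath ((X ⊗ Y : SSet.{u}).δ j.castSucc r) l = sPath r (j.castSucc.succAbove l) := by
  obtain ⟨hij, hv, hh⟩ := hb
  rw [isVertical_iff] at hv
  rw [isHorizontal_iff] at hh
  have e : i.succ = j.castSucc := Fin.ext hij
  -- The vertex before the bend shares its first coordinate and the vertex after it shares its
  -- second, so neither surjection needs the bend vertex.
  obtain ⟨a1, a2⟩ := degVal_δ_of_eq r.1 (k := j.castSucc) (k' := i.castSucc)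
    (by rw [← e]; exact Fin.castSucc_lt_succ.ne) (by rw [← e]; exact hv.1.symm)
  obtain ⟨b1, b2⟩ := degVal_δ_of_eq r.2 (k := j.castSucc) (k' := j.succ)
    Fin.castSucc_lt_succ.ne' hh.2
  exact ⟨Prod.ext a1 b1, fun l => Prod.ext (a2 l) (b2 l)⟩

lemma bend_face_nonDegenerate {r : (X ⊗ Y : SSet.{u}) _⦋n + 1⦌}
    (hr : r ∈ (X ⊗ Y : SSet.{u}).nonDegenerate (n + 1)) {i j : Fin (n + 1)}
    (hb : IsBend (sPath r) i j) :
    (X ⊗ Y : SSet.{u}).δ j.castSucc r ∈ (X ⊗ Y : SSet.{u}).nonDegenerate n := by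
  rw [mem_nonDegenerate_prod_iff]
  intro l h
  rw [(bend_face hb).2, (bend_face hb).2] at h
  exact Fin.castSucc_lt_succ.ne' (Fin.succAbove_right_injective (sPath_injective hr h))

variable {s : (normalizedComplex (X ⊗ Y)).cell n} {t : (normalizedComplex (X ⊗ Y)).cell (n + 1)}

/-- A bend vertex has a step before it, so its index is a successor. The single index `i` also
locates the diagonal step of the source. -/
lemma ezField_iff : ezField X Y n s t ↔ ∃ i : Fin n,
    IsBend (sPath t.1) i.castSucc i.succ ∧ EventFreeFrom (sPath t.1) (i + 1) ∧
      s.1 = (X ⊗ Y : SSet.{u}).δ i.succ.castSucc t.1 := by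
  refine ⟨?_, fun ⟨i, hb, hf, hs⟩ => ⟨i.castSucc, i.succ, hb, by simpa using hf, hs⟩⟩
  rintro ⟨i, j, hb, hf, hs⟩
  have hij := hb.1
  obtain ⟨j, rfl⟩ := Fin.exists_succ_eq.2 (show j ≠ 0 by rintro rfl; simp at hij)
  obtain rfl : i = j.castSucc := Fin.ext (by simpa using hij)
  exact ⟨j, hb, by simpa using hf, hs⟩

/-- The index of the diagonal step of the source of a vector determines the target. -/
lemma ezField_source {i : Fin n} (hb : IsBend (sPath t.1) i.castSucc i.succ)
    (hf : EventFreeFrom (sPath t.1) (i + 1))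
    (hs : s.1 = (X ⊗ Y : SSet.{u}).δ i.succ.castSucc t.1) :
    IsDiagonal (sPath s.1) i ∧ EventFreeFrom (sPath s.1) (i + 1) ∧
      t.1 = (X.σ i.castSucc s.1.1, Y.σ i.succ s.1.2) := by
  have hπ := (bend_face hb).2
  rw [hs]
  have hv := hb.2.1
  have hh := hb.2.2
  rw [isVertical_iff] at hv
  rw [isHorizontal_iff] at hh
  refine ⟨?_, ?_, ?_⟩
  · rw [isDiagonal_iff, hπ, hπ, Fin.succAbove_of_castSucc_lt _ i.castSucc (by simp [Fin.lt_def]),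
      Fin.succAbove_of_le_castSucc _ i.succ le_rfl]
    have e : (i.castSucc.succ : Fin (n + 2)) = i.succ.castSucc := rfl
    rw [e] at hv
    omega
  · rw [eventFreeFrom_skip hπ (by simp)]
    exact hf.mono (by omega)
  · exact Prod.ext (σ_δ_eq_self t.1.1 i.castSucc _ (.inr rfl) hv.1).symm
      (σ_δ_eq_self t.1.2 i.succ _ (.inl rfl) hh.2).symm

lemma ezField_isSourcePath (h : ezField X Y n s t) : IsSourcePath (sPath s.1) := by
  obtain ⟨i, hb, hf, hs⟩ := ezField_iff.1 h
  obtain ⟨hd, hf', -⟩ := ezField_source hb hf hs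
  exact ⟨i, hd, hf'⟩

lemma ezField_isTargetPath (h : ezField X Y n s t) : IsTargetPath (sPath t.1) := by
  obtain ⟨i, j, hb, hf, -⟩ := h
  exact ⟨i, j, hb, hf⟩

/-- The first diagonal of the source fixes `i`, and then `t` is recovered by two degeneracies. -/
lemma ezField_target_unique {t' : (normalizedComplex (X ⊗ Y)).cell (n + 1)}
    (h : ezField X Y n s t) (h' : ezField X Y n s t') : t = t' := by
  obtain ⟨i, hb, hf, hs⟩ := ezField_iff.1 h
  obtain ⟨hd, hf, ht⟩ := ezField_source hb hf hs
  obtain ⟨i', hb', hf', hs'⟩ := ezField_iff.1 h'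
  obtain ⟨hd', hf', ht'⟩ := ezField_source hb' hf' hs'
  obtain rfl := first_diagonal_unique hd hf hd' hf'
  exact Subtype.ext (ht.trans ht'.symm)

lemma ezField_source_unique {s' : (normalizedComplex (X ⊗ Y)).cell n}
    (h : ezField X Y n s t) (h' : ezField X Y n s' t) : s = s' := by
  obtain ⟨i, j, hb, hf, hs⟩ := h
  obtain ⟨i', j', hb', hf', hs'⟩ := h'
  obtain rfl := first_bend_unique hb hf hb' hf'
  exact Subtype.ext (hs.trans hs'.symm)

lemma exists_ezField_of_isTargetPath (t : (normalizedComplex (X ⊗ Y)).cell (n + 1))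
    (h : IsTargetPath (sPath t.1)) : ∃ s, ezField X Y n s t := by
  obtain ⟨i, j, hb, hf⟩ := h
  exact ⟨⟨_, bend_face_nonDegenerate t.2 hb⟩, i, j, hb, hf, rfl⟩

section Insert

variable (r : (X ⊗ Y : SSet.{u}) _⦋n⦌) (i : Fin n)

/-- The simplex obtained by replacing the step `i` of the path by a vertical and a horizontal
step. -/
def insertBend : (X ⊗ Y : SSet.{u}) _⦋n + 1⦌ := (X.σ i.castSucc r.1, Y.σ i.succ r.2)

lemma sPath_insertBend (k : Fin (n + 2)) : sPath (insertBend r i) k =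
    ((sPath r (i.castSucc.predAbove k)).1, (sPath r (i.succ.predAbove k)).2) :=
  Prod.ext (degVal_σ _ _ _) (degVal_σ _ _ _)

lemma sPath_insertBend_castSucc {l : Fin (n + 1)} (hl : l ≤ i.castSucc) :
    sPath (insertBend r i) l.castSucc = sPath r l := by
  rw [sPath_insertBend, Fin.predAbove_castSucc_of_le _ _ hl,
    Fin.predAbove_castSucc_of_le _ _ (hl.trans Fin.castSucc_lt_succ.le)]

lemma sPath_insertBend_succ {l : Fin (n + 1)} (hl : i.succ ≤ l) :
    sPath (insertBend r i) l.succ = sPath r l := by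
  rw [sPath_insertBend, Fin.predAbove_succ_of_le _ _ hl,
    Fin.predAbove_succ_of_le _ _ (Fin.castSucc_lt_succ.le.trans hl)]

lemma sPath_insertBend_middle : sPath (insertBend r i) i.succ.castSucc =
    ((sPath r i.castSucc).1, (sPath r i.succ).2) := by
  rw [sPath_insertBend, Fin.predAbove_castSucc_self]
  congr 2
  exact congrArg (sPath r) (Fin.predAbove_succ_self i.castSucc)

/-- Face `i + 1` cancels both `σ i` in the first factor and `σ (i + 1)` in the second. -/
lemma δ_insertBend : (X ⊗ Y : SSet.{u}).δ i.succ.castSucc (insertBend r i) = r :=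
  Prod.ext (SSet.δ_comp_σ_succ_apply (S := X) (i := i.castSucc) r.1)
    (SSet.δ_comp_σ_self_apply (S := Y) (i := i.succ) r.2)

variable {r i}

lemma isBend_insertBend (hd : IsDiagonal (sPath r) i) :
    IsBend (sPath (insertBend r i)) i.castSucc i.succ := by
  rw [isDiagonal_iff] at hd
  refine ⟨rfl, ?_, ?_⟩
  · rw [isVertical_iff, sPath_insertBend_castSucc r i le_rfl]
    have e : (i.castSucc.succ : Fin (n + 2)) = i.succ.castSucc := rfl
    rw [e, sPath_insertBend_middle]
    exact ⟨rfl, hd.2⟩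
  · rw [isHorizontal_iff, sPath_insertBend_succ r i le_rfl, sPath_insertBend_middle]
    exact ⟨hd.1, rfl⟩

lemma sPath_eq_sPath_insertBend (hd : IsDiagonal (sPath r) i) (l : Fin (n + 1)) :
    sPath r l = sPath (insertBend r i) (i.succ.castSucc.succAbove l) := by
  conv_lhs => rw [← δ_insertBend r i]
  exact (bend_face (isBend_insertBend hd)).2 l

/-- The new step `i + 1` is horizontal and so begins no event; the later steps are those of the old
path, shifted by one. -/
lemma eventFreeFrom_insertBend (hd : IsDiagonal (sPath r) i)
    (hf : EventFreeFrom (sPath r) (i + 1)) :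
    EventFreeFrom (sPath (insertBend r i)) (i + 1) := by
  have hb := isBend_insertBend hd
  intro k hk
  by_cases hk' : k = i.succ
  · subst hk'
    exact ⟨hb.2.2.not_isDiagonal, fun j hb' => hb.2.2.not_isVertical hb'.2.1⟩
  · refine (eventFreeFrom_skip (sPath_eq_sPath_insertBend hd) (m := i + 1) (by simp)).1 hf k ?_
    have : (k : ℕ) ≠ i + 1 := fun h => hk' (Fin.ext h)
    omega

lemma insertBend_nonDegenerate (hr : r ∈ (X ⊗ Y : SSet.{u}).nonDegenerate n)
    (hd : IsDiagonal (sPath r) i) :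
    insertBend r i ∈ (X ⊗ Y : SSet.{u}).nonDegenerate (n + 1) := by
  have hb := isBend_insertBend hd
  rw [mem_nonDegenerate_prod_iff] at hr ⊢
  intro k
  rcases lt_trichotomy k i.castSucc with hk | rfl | hk
  · obtain ⟨k, rfl⟩ := Fin.exists_castSucc_eq.2 (hk.trans_le (Fin.le_last _)).ne
    have e : (k.castSucc.succ : Fin (n + 2)) = k.succ.castSucc := rfl
    rw [e, sPath_insertBend_castSucc r i hk, sPath_insertBend_castSucc r i hk.le]
    exact hr k
  · intro h
    have := (isVertical_iff _).1 hb.2.1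
    rw [h] at this
    omega
  · rcases eq_or_lt_of_le (show i.succ ≤ k from hk) with rfl | hk
    · intro h
      have := (isHorizontal_iff _).1 hb.2.2
      rw [h] at this
      omega
    · obtain ⟨k, rfl⟩ := Fin.exists_succ_eq.2 ((Fin.zero_le _).trans_lt hk).ne'
      have e : (k.succ.castSucc : Fin (n + 2)) = k.castSucc.succ := rfl
      rw [e, sPath_insertBend_succ r i hk.le, sPath_insertBend_succ r i (by
        rw [Fin.lt_def] at hk; rw [Fin.le_def]; simp at hk ⊢; omega)]
      exact hr k

end Insert

lemma exists_ezField_of_isSourcePath (s : (normalizedComplex (X ⊗ Y)).cell n)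
    (h : IsSourcePath (sPath s.1)) : ∃ t, ezField X Y n s t := by
  obtain ⟨i, hd, hf⟩ := h
  exact ⟨⟨insertBend s.1 i, insertBend_nonDegenerate s.2 hd⟩, ezField_iff.2
    ⟨i, isBend_insertBend hd, eventFreeFrom_insertBend hd hf, (δ_insertBend s.1 i).symm⟩⟩

end EZField

/-! ### Counting lattice points above a path -/

section Above

variable {X Y : SSet.{u}} {n : ℕ}

lemma pointsAbove_lt {m : ℕ} {r : (X ⊗ Y : SSet.{u}) _⦋n⦌} {s : (X ⊗ Y : SSet.{u}) _⦋m⦌}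
    (hb : bidim r = bidim s)
    (h : ∀ a b, (∀ k, (sPath r k).1 = a → (sPath r k).2 < b) →
      ∀ k, (sPath s k).1 = a → (sPath s k).2 < b)
    {a b : ℕ} (ha : a ≤ (bidim s).1) (hb' : b ≤ (bidim s).2)
    (hs : ∀ k, (sPath s k).1 = a → (sPath s k).2 < b)
    (hr : ∃ k, (sPath r k).1 = a ∧ b ≤ (sPath r k).2) : pointsAbove r < pointsAbove s := by
  classical
  unfold pointsAbove
  rw [hb]
  refine Finset.card_lt_card (Finset.ssubset_iff_of_subset ?_ |>.2 ⟨(a, b), ?_, ?_⟩)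
  · intro ab hab
    rw [Finset.mem_filter] at hab ⊢
    exact ⟨hab.1, h _ _ hab.2⟩
  · simp only [Finset.mem_filter, Finset.mem_product, Finset.mem_range]
    exact ⟨⟨by omega, by omega⟩, hs⟩
  · rw [Finset.mem_filter, not_and]
    intro _ h'
    obtain ⟨k, hk, hk'⟩ := hr
    exact absurd (h' k hk) (not_lt.2 hk')

/-- A vertex which is the only one of maximal height in its column, but neither alone in its column
nor in its row, is the vertex of a bend. -/
lemma exists_isBend_or_exists_gt {r : (X ⊗ Y : SSet.{u}) _⦋n⦌}
    (hr : r ∈ (X ⊗ Y : SSet.{u}).nonDegenerate n) {k : Fin (n + 1)}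
    (h1 : ∃ k', k' ≠ k ∧ (sPath r k').1 = (sPath r k).1)
    (h2 : ∃ k', k' ≠ k ∧ (sPath r k').2 = (sPath r k).2) :
    (∃ i j, IsBend (sPath r) i j ∧ j.castSucc = k) ∨
      ∃ k', k < k' ∧ (sPath r k').1 = (sPath r k).1 := by
  obtain ⟨k', hk', e1⟩ := h1
  rcases lt_or_gt_of_ne hk' with hlt | hgt
  swap
  · exact Or.inr ⟨k', hgt, e1⟩
  obtain ⟨i, rfl⟩ := Fin.exists_succ_eq.2 ((Fin.zero_le _).trans_lt hlt).ne'
  -- An earlier vertex in the same column squeezes the first coordinate, so the step arriving at `k`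
  -- is vertical.
  have m1 := sPath_fst_mono r (show k' ≤ i.castSucc from Nat.lt_succ_iff.1 hlt)
  have m2 := sPath_fst_mono r (Fin.castSucc_lt_succ (i := i)).le
  have hst := isStep_of_nonDegenerate hr i
  simp only at m1 m2
  have hv : IsVertical (sPath r) i := by
    rw [isVertical_iff, isHorizontal_iff, isDiagonal_iff] at hst
    rw [isVertical_iff]
    omega
  have hv' := (isVertical_iff _).1 hv
  -- This vertical step strictly raises the height, so a companion in the row of `k` comes later and
  -- forces the outgoing step to be horizontal.
  obtain ⟨k₂, hk₂, e2⟩ := h2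
  rcases lt_or_gt_of_ne hk₂ with hlt₂ | hgt₂
  · have := sPath_snd_mono r (show k₂ ≤ i.castSucc from Nat.lt_succ_iff.1 hlt₂)
    simp only at this
    omega
  · obtain ⟨j, hj⟩ := Fin.exists_castSucc_eq.2 (hgt₂.trans_le (Fin.le_last _)).ne
    rw [← hj] at hgt₂ e2
    have m3 := sPath_snd_mono r (show j.succ ≤ k₂ from hgt₂)
    have m4 := sPath_snd_mono r (Fin.castSucc_lt_succ (i := j)).le
    have hst := isStep_of_nonDegenerate hr j
    simp only at m3 m4
    refine Or.inl ⟨i, j, ⟨congrArg Fin.val hj.symm, hv, ?_⟩, hj⟩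
    rw [isVertical_iff, isHorizontal_iff, isDiagonal_iff] at hst
    rw [isHorizontal_iff]
    omega

end Above

/-! ### The effect of the twist, and the Lyapunov function -/

section Twisted

variable {G : SimplicialObject GrpCat.{w}} {F B : SSet.{u}}
  (act : SimplicialAction G F) (τ : TwistingFunction G B) {n : ℕ}

/-- Twisting only affects faces whose dimension in the base drops. -/
lemma twistedProduct_δ_eq_or (x : F _⦋n + 1⦌) (b : B _⦋n + 1⦌) (k : Fin (n + 2)) :
    (twistedProduct act τ).δ k (x, b) = (F.δ k x, B.δ k b) ∨
      ((twistedProduct act τ).δ k (x, b)).2 = B.δ k b ∧ geomDim (B.δ k b) < geomDim b := by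
  induction k using Fin.cases with
  | succ k => exact Or.inl (twistedProduct_δ_succ act τ k x b)
  | zero =>
    rw [twistedProduct_δ_zero]
    rcases degVal_δ b 0 with ⟨⟨k, hk, e⟩, -⟩ | h
    · left
      -- If some other vertex has the value of vertex `0`, then by monotonicity vertex `1` does.
      -- Hence `b = η₀ ∂₀ b` and `τ(b) = e`.
      have h1 := degVal_mono b (show (Fin.succ 0 : Fin (n + 2)) ≤ k from
        Fin.pos_of_ne_zero hk)
      have h2 : degVal b (Fin.succ 0) = degVal b (Fin.castSucc 0) := by
        have := degVal_zero b
        rw [Fin.castSucc_zero]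
        omega
      have h3 := σ_δ_eq_self b 0 0 (Or.inl rfl) h2
      rw [← h3, τ.σ_zero, act.one_smul]
    · exact Or.inr ⟨rfl, h⟩

/-- The effect of a face operator on the bidimension and the path. -/
lemma twisted_face_cases (r : (F ⊗ B : SSet.{u}) _⦋n + 1⦌) (k : Fin (n + 2))
    (r' : (F ⊗ B : SSet.{u}) _⦋n⦌) (h : r' = (twistedProduct act τ).δ k r) :
    (bidim r').2 < (bidim r).2 ∨ ((bidim r').2 = (bidim r).2 ∧ (bidim r').1 < (bidim r).1) ∨
      (bidim r' = bidim r ∧ (∀ l, sPath r' l = sPath r (k.succAbove l)) ∧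
        (∃ k', k' ≠ k ∧ (sPath r k').1 = (sPath r k).1) ∧
        ∃ k', k' ≠ k ∧ (sPath r k').2 = (sPath r k).2) := by
  obtain ⟨x, b⟩ := r
  rcases twistedProduct_δ_eq_or act τ x b k with e | ⟨e, hlt⟩
  · have h' : r' = (F.δ k x, B.δ k b) := h.trans e
    subst h'
    rcases degVal_δ b k with ⟨hb1, hb2, hb3⟩ | hb
    · rcases degVal_δ x k with ⟨hx1, hx2, hx3⟩ | hx
      · exact Or.inr (Or.inr ⟨Prod.ext hx2 hb2, fun l => Prod.ext (hx3 l) (hb3 l), hx1, hb1⟩)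
      · exact Or.inr (Or.inl ⟨hb2, hx⟩)
    · exact Or.inl hb
  -- The group element may change the fibre component arbitrarily, but the base component alone
  -- shows that `q` drops.
  · left
    have h' : r'.2 = B.δ k b := (congrArg Prod.snd h).trans e
    change geomDim r'.2 < geomDim b
    rwa [h']

lemma simplexChain_apply {X : SSet.{u}} (x : X _⦋n⦌) (s : X.nonDegenerate n) [Decidable (x = s.1)] :
    simplexChain X x s = if x = s.1 then 1 else 0 := by
  classical
  by_cases hx : x ∈ X.nonDegenerate n
  · rw [simplexChain_of_nonDegenerate X ⟨x, hx⟩, Finsupp.single_apply]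
    exact if_congr Subtype.ext_iff rfl rfl
  · rw [if_neg (fun h : x = s.1 => hx (h ▸ s.2)), simplexChain_of_degenerate X (by
      simpa [SSet.nonDegenerate] using hx)]
    rfl

lemma normBd_single_apply {X : SSet.{u}} [DecidableEq (X _⦋n⦌)] (s : X.nonDegenerate n)
    (t : X.nonDegenerate (n + 1)) : normBd X n (Finsupp.single t 1) s =
      ∑ k : Fin (n + 2), if X.δ k t.1 = s.1 then (-1 : ℤ) ^ (k : ℕ) else 0 := by
  rw [← simplexChain_of_nonDegenerate, normBd_simplexChain, Finsupp.finsetSum_apply]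
  refine Finset.sum_congr rfl fun k _ => ?_
  rw [Finsupp.smul_apply, simplexChain_apply]
  simp

lemma incidence_eq_sum {X : SSet.{u}} [DecidableEq (X _⦋n⦌)] (s : (normalizedComplex X).cell n)
    (t : (normalizedComplex X).cell (n + 1)) : incidence (normalizedComplex X) s t =
      ∑ k : Fin (n + 2), if X.δ k t.1 = s.1 then (-1 : ℤ) ^ (k : ℕ) else 0 :=
  normBd_single_apply s t

lemma exists_eq_δ_of_isFace {X : SSet.{u}} {s : (normalizedComplex X).cell n}
    {t : (normalizedComplex X).cell (n + 1)} (h : IsFace (normalizedComplex X) s t) :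
    ∃ k, s.1 = X.δ k t.1 := by
  classical
  rw [IsFace, incidence_eq_sum] at h
  obtain ⟨k, -, hk⟩ := Finset.exists_ne_zero_of_sum_ne_zero h
  exact ⟨k, by_contra fun hne => hk (if_neg (Ne.symm hne))⟩

variable {act τ}

/-- Only one index contributes to the incidence. A face of `t` equal to `s` keeps the bidimension,
so its path is that of `t` with one vertex omitted, and injectivity of the path determines that
vertex. -/
lemma twistedEZField_isRegularFace {s : (normalizedComplex (twistedProduct act τ)).cell n}
    {t : (normalizedComplex (twistedProduct act τ)).cell (n + 1)}
    (h : twistedEZField act τ n s t) : IsRegularFace _ s t := by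
  classical
  obtain ⟨i, j, hb, hf, hs⟩ := h
  have hface := bend_face hb
  rw [← hs] at hface
  have hj : (twistedProduct act τ).δ j.castSucc t.1 = s.1 := by
    have hij := hb.1
    obtain ⟨l, hl⟩ := Fin.exists_succ_eq.2 (show j.castSucc ≠ 0 by
      intro h; rw [Fin.ext_iff] at h; simp at h; simp [h] at hij)
    rw [← hl] at hs ⊢
    exact (twistedProduct_δ_succ act τ l t.1.1 t.1.2).trans hs.symm
  have key : incidence _ s t = (-1 : ℤ) ^ (j.castSucc : ℕ) := by
    rw [incidence_eq_sum, Finset.sum_eq_single j.castSucc, if_pos hj]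
    · intro k _ hk
      rw [if_neg]
      intro hk'
      rcases twisted_face_cases act τ (untwist act τ t).1 k (untwist act τ s).1 hk'.symm with
        h | h | ⟨-, h, -⟩
      · rw [hface.1] at h
        exact h.false
      · rw [hface.1] at h
        exact h.2.false
      · refine hk (Fin.succAbove_left_injective (funext fun l => ?_))
        exact sPath_injective (untwist act τ t).2 ((h l).symm.trans (hface.2 l))
    · simp
  rw [IsRegularFace, key]
  exact neg_one_pow_eq_or ℤ _

variable (act τ)

lemma untwist_injective : Function.Injective
    (untwist act τ : (normalizedComplex (twistedProduct act τ)).cell n → _) :=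
  fun _ _ h => Subtype.ext (congrArg Subtype.val h :)

/-- A non-degenerate simplex of `F × B`, seen as a non-degenerate simplex of `F ×_τ B`. -/
def retwist (c : (normalizedComplex (F ⊗ B)).cell n) :
    (normalizedComplex (twistedProduct act τ)).cell n :=
  ⟨c.1, (mem_nonDegenerate_twistedProduct_iff act τ c.1).2 c.2⟩

/-- Apart from regularity, the conditions do not involve the differential and carry over from `F ×
B`. -/
lemma twistedEZField_isDiscreteVectorField : IsDiscreteVectorField (twistedEZField act τ) where
  regular h := twistedEZField_isRegularFace h
  target_unique h h' := untwist_injective act τ (ezField_target_unique h h')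
  source_unique h h' := untwist_injective act τ (ezField_source_unique h h')
  not_source_of_target h h' :=
    (ezField_isSourcePath h').not_isTargetPath (ezField_isTargetPath h)

lemma isSource_twistedEZField_iff (c : (normalizedComplex (twistedProduct act τ)).cell n) :
    IsSource (twistedEZField act τ) c ↔ IsSourcePath (sPath (untwist act τ c).1) := by
  refine ⟨fun ⟨t, ht⟩ => ezField_isSourcePath ht, fun h => ?_⟩
  obtain ⟨t, ht⟩ := exists_ezField_of_isSourcePath _ h
  exact ⟨retwist act τ t, ht⟩

lemma isTarget_twistedEZField_iff (c : (normalizedComplex (twistedProduct act τ)).cell n) :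
    IsTarget (twistedEZField act τ) c ↔ IsTargetPath (sPath (untwist act τ c).1) := by
  obtain _ | n := n
  · exact ⟨fun h => h.elim, fun ⟨i, _⟩ => i.elim0⟩
  · refine ⟨fun ⟨s, hs⟩ => ezField_isTargetPath hs, fun h => ?_⟩
    obtain ⟨s, hs⟩ := exists_ezField_of_isTargetPath _ h
    exact ⟨retwist act τ s, hs⟩

lemma isCritical_twistedEZField_iff (c : (normalizedComplex (twistedProduct act τ)).cell n) :
    IsCritical (twistedEZField act τ) c ↔ IsCriticalPath (sPath (untwist act τ c).1) := by
  rw [IsCritical, isSource_twistedEZField_iff, isTarget_twistedEZField_iff, isCriticalPath_iff]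

/-- Relative to the path of `t`, omitting the bend vertex `j` puts one more point above the path of
`s`. Omitting `k` adds none for `s'`, because a later vertex in the column of `k` is at least as
high; otherwise `k` would be a bend vertex, which is impossible as `s'` is a source. -/
lemma twistedEZField_isLyapunov : IsLyapunov (twistedEZField act τ) (fun _ c =>
    toLex ((bidim (untwist act τ c).1).2,
      toLex ((bidim (untwist act τ c).1).1, pointsAbove (untwist act τ c).1))) := by
  intro n s s' t t' hst hs't' hface hne
  obtain ⟨k, hk⟩ := exists_eq_δ_of_isFace hface
  have hsrc := ezField_isSourcePath hs't'
  obtain ⟨i, j, hb, hf, hs⟩ := hst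
  have hbf := bend_face hb
  rw [← hs] at hbf
  simp only [Prod.Lex.toLex_lt_toLex]
  rw [hbf.1]
  rcases twisted_face_cases act τ (untwist act τ t).1 k (untwist act τ s').1 hk with
    h | h | ⟨hbi, hp, h1, h2⟩
  · exact Or.inl h
  · exact Or.inr ⟨h.1, Or.inl h.2⟩
  · rw [hbi]
    refine Or.inr ⟨rfl, Or.inr ⟨rfl, ?_⟩⟩
    have hkj : k ≠ j.castSucc := by
      rintro rfl
      refine hne (Subtype.ext (hk.trans ?_))
      have hij := hb.1
      obtain ⟨l, hl⟩ := Fin.exists_succ_eq.2 (show j.castSucc ≠ 0 by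
        intro h; rw [Fin.ext_iff] at h; simp at h; simp [h] at hij)
      rw [← hl] at hs ⊢
      exact (twistedProduct_δ_succ act τ l t.1.1 t.1.2).trans hs.symm
    have hij := hb.1
    have hv := (isVertical_iff _).1 hb.2.1
    have hh := (isHorizontal_iff _).1 hb.2.2
    have eij : i.succ = j.castSucc := Fin.ext hij
    rw [eij] at hv
    have habove : ∃ k', k < k' ∧
        (sPath (untwist act τ t).1 k').1 = (sPath (untwist act τ t).1 k).1 := by
      refine (exists_isBend_or_exists_gt (untwist act τ t).2 h1 h2).resolve_left ?_
      rintro ⟨i', j', hb', rfl⟩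
      have hij' := hb'.1
      -- A bend before `j` could be omitted without disturbing the bend at `j`, making `s'` a
      -- target. A bend after `j` would contradict that the one at `j` is met first.
      rcases lt_trichotomy (j' : ℕ) j with hlt | heq | hgt
      · refine hsrc.not_isTargetPath (isTargetPath_skip hp hb hf ?_)
        -- The two bends cannot be at adjacent vertices: step `i` would be both horizontal and
        -- vertical.
        refine lt_of_le_of_ne (show (j' : ℕ) ≤ i by omega) fun he => ?_
        obtain rfl : j' = i := Fin.ext he
        exact hb'.2.2.not_isVertical hb.2.1
      · exact hkj (congrArg Fin.castSucc (Fin.ext heq))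
      · exact (hf i' (by omega)).2 j' hb'
    -- The witness is the bend vertex itself: it is on the path of `s'`, but strictly above that of
    -- `s`.
    refine pointsAbove_lt (hbi.trans hbf.1.symm) ?_
      (a := (sPath (untwist act τ t).1 j.castSucc).1)
      (b := (sPath (untwist act τ t).1 j.castSucc).2) ?_ ?_ ?_ ?_
    · intro a b hab l hl
      rw [hbf.2] at hl ⊢
      generalize j.castSucc.succAbove l = m at hl ⊢
      have hskip : ∀ m, m ≠ k → (sPath (untwist act τ t).1 m).1 = a →
          (sPath (untwist act τ t).1 m).2 < b := by
        intro m hm hma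
        obtain ⟨l', rfl⟩ := Fin.exists_succAbove_eq hm
        rw [← hp] at hma ⊢
        exact hab l' hma
      by_cases hmk : m = k
      · subst hmk
        obtain ⟨k', hlt, e⟩ := habove
        exact lt_of_le_of_lt (sPath_snd_mono (untwist act τ t).1 hlt.le)
          (hskip k' hlt.ne' (e.trans hl))
      · exact hskip m hmk hl
    · rw [hbf.1]
      exact degVal_le _ _
    · rw [hbf.1]
      exact degVal_le _ _
    · intro l hl
      rw [hbf.2] at hl ⊢
      -- Vertices before the bend are strictly lower; those after it lie in columns further right.
      rcases lt_or_gt_of_ne (Fin.succAbove_ne j.castSucc l) with hlt | hgt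
      · have := sPath_snd_mono (untwist act τ t).1
          (show j.castSucc.succAbove l ≤ i.castSucc by
            rw [Fin.lt_def] at hlt; rw [Fin.le_def]; simp at hlt ⊢; omega)
        simp only at this
        omega
      · have := sPath_fst_mono (untwist act τ t).1
          (show j.succ ≤ j.castSucc.succAbove l from hgt)
        simp only at this
        omega
    · obtain ⟨l, hl⟩ := Fin.exists_succAbove_eq hkj.symm
      exact ⟨l, by rw [hp, hl], by rw [hp, hl]⟩

end Twisted

/-! ### The critical cells -/

section Critical

variable {X Y : SSet.{u}} {n p q : ℕ}

/-- The map `[n] ⟶ [p]`, `k ↦ min k p`. -/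
def prismLeft (n p : ℕ) : ⦋n⦌ ⟶ ⦋p⦌ :=
  SimplexCategory.Hom.mk ⟨fun k => ⟨min k p, Nat.lt_succ_of_le (min_le_right _ _)⟩, fun i j h => by
    simp only [Fin.le_def] at h ⊢; omega⟩

/-- The map `[n] ⟶ [q]`, `k ↦ max 0 (k - p)`, where `p + q = n`. -/
def prismRight (h : p + q = n) : ⦋n⦌ ⟶ ⦋q⦌ :=
  SimplexCategory.Hom.mk ⟨fun k => ⟨(k : ℕ) - p, by
    have h : (k : ℕ) < n + 1 := k.isLt
    change (k : ℕ) - p < q + 1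
    omega⟩, fun i j h => by
    simp only [Fin.le_def] at h ⊢; omega⟩

lemma epi_prismLeft (h : p ≤ n) : Epi (prismLeft n p) := by
  rw [SimplexCategory.epi_iff_surjective]
  intro a
  have ha : (a : ℕ) < p + 1 := a.isLt
  refine ⟨(⟨a, by omega⟩ : Fin (n + 1)), Fin.ext ?_⟩
  change min (a : ℕ) p = a
  omega

lemma epi_prismRight (h : p + q = n) : Epi (prismRight h) := by
  rw [SimplexCategory.epi_iff_surjective]
  intro a
  have ha : (a : ℕ) < q + 1 := a.isLt
  refine ⟨(⟨p + a, by omega⟩ : Fin (n + 1)), Fin.ext ?_⟩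
  change p + (a : ℕ) - p = a
  omega

/-- The last simplex of a prism, as a simplex of dimension `n = p + q`. -/
def lastSimplexOf (h : p + q = n) (x : X _⦋p⦌) (y : Y _⦋q⦌) : (X ⊗ Y : SSet.{u}) _⦋n⦌ :=
  (X.map (prismLeft n p).op x, Y.map (prismRight h).op y)

section

variable (h : p + q = n) (x : X.nonDegenerate p) (y : Y.nonDegenerate q)

lemma bidim_lastSimplexOf : bidim (lastSimplexOf h x.1 y.1) = (p, q) := by
  have := epi_prismLeft (show p ≤ n by omega)
  have := epi_prismRight h
  exact Prod.ext (geomDim_eq _ (prismLeft n p) x rfl) (geomDim_eq _ (prismRight h) y rfl)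

lemma sPath_lastSimplexOf (k : Fin (n + 1)) :
    sPath (lastSimplexOf h x.1 y.1) k = (min (k : ℕ) p, (k : ℕ) - p) := by
  have := epi_prismLeft (show p ≤ n by omega)
  have := epi_prismRight h
  exact Prod.ext (degVal_eq _ (prismLeft n p) x rfl k) (degVal_eq _ (prismRight h) y rfl k)

lemma lastSimplexOf_nonDegenerate :
    lastSimplexOf h x.1 y.1 ∈ (X ⊗ Y : SSet.{u}).nonDegenerate n := by
  rw [mem_nonDegenerate_prod_iff]
  intro i
  rw [sPath_lastSimplexOf, sPath_lastSimplexOf]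
  simp only [Fin.val_succ, Fin.val_castSucc, ne_eq, Prod.mk.injEq]
  omega

lemma isCriticalPath_lastSimplexOf : IsCriticalPath (sPath (lastSimplexOf h x.1 y.1)) := by
  intro i _
  refine ⟨?_, ?_⟩
  · rw [isDiagonal_iff, sPath_lastSimplexOf, sPath_lastSimplexOf]
    simp only [Fin.val_succ, Fin.val_castSucc]
    omega
  · rintro j ⟨hij, hv, hh⟩
    rw [isVertical_iff, sPath_lastSimplexOf, sPath_lastSimplexOf] at hv
    rw [isHorizontal_iff, sPath_lastSimplexOf, sPath_lastSimplexOf] at hh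
    simp only [Fin.val_succ, Fin.val_castSucc] at hv hh
    omega

end

/-- The path of a critical simplex. -/
lemma sPath_of_isCriticalPath {r : (X ⊗ Y : SSet.{u}) _⦋n⦌}
    (hr : r ∈ (X ⊗ Y : SSet.{u}).nonDegenerate n) (hc : IsCriticalPath (sPath r)) :
    (bidim r).1 + (bidim r).2 = n ∧
      ∀ k, sPath r k = (min (k : ℕ) (bidim r).1, (k : ℕ) - (bidim r).1) := by
  have hstep : ∀ i, IsVertical (sPath r) i ∨ IsHorizontal (sPath r) i := fun i => by
    rcases isStep_of_nonDegenerate hr i with h | h | h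
    · exact Or.inl h
    · exact Or.inr h
    · exact absurd h (hc i (Nat.zero_le _)).1
  have hzero : sPath r 0 = (0, 0) := Prod.ext (degVal_zero r.1) (degVal_zero r.2)
  have hlast : sPath r (Fin.last n) = bidim r := Prod.ext (degVal_last r.1) (degVal_last r.2)
  -- Without diagonals, each step raises the coordinate sum by exactly one.
  have hsum : ∀ k, (sPath r k).1 + (sPath r k).2 = (k : ℕ) := by
    intro k
    induction k using Fin.induction with
    | zero => simp [hzero]
    | succ i ih =>
      have := hstep i
      rw [isVertical_iff, isHorizontal_iff] at this
      simp only [Fin.val_succ, Fin.val_castSucc] at ih ⊢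
      omega
  -- Once the path has left the bottom row, a horizontal step would complete a bend.
  have hvert : ∀ m, ∀ i : Fin n, (i : ℕ) = m → 0 < (sPath r i.castSucc).2 →
      IsVertical (sPath r) i := by
    intro m
    induction m with
    | zero =>
      intro i hi h0
      have : i.castSucc = 0 := Fin.ext hi
      rw [this, hzero] at h0
      exact absurd h0 (lt_irrefl _)
    | succ m ih =>
      intro i hi h0
      let l : Fin n := ⟨m, by omega⟩
      have hl : l.succ = i.castSucc := Fin.ext hi.symm
      have hv : IsVertical (sPath r) l := by
        by_cases hpos : 0 < (sPath r l.castSucc).2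
        · exact ih l rfl hpos
        · refine (hstep l).resolve_right fun hh => ?_
          rw [isHorizontal_iff, hl] at hh
          omega
      exact (hstep i).resolve_right fun hh => (hc l (Nat.zero_le _)).2 i ⟨hi.symm, hv, hh⟩
  -- Above the bottom row only vertical steps remain, so the first coordinate already has its final
  -- value.
  have hend : ∀ k, 0 < (sPath r k).2 → (sPath r k).1 = (bidim r).1 := by
    intro k
    induction k using Fin.reverseInduction with
    | last => intro _; rw [hlast]
    | cast i ih =>
      intro h0
      have hv := (isVertical_iff _).1 (hvert i i rfl h0)
      rw [← ih (by omega), hv.1]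
  refine ⟨?_, fun k => ?_⟩
  · have := hsum (Fin.last n)
    rwa [hlast] at this
  · have h1 := hsum k
    have h2 := hend k
    have h3 : (sPath r k).1 ≤ (bidim r).1 := degVal_le r.1 k
    refine Prod.ext ?_ ?_
    · simp only; omega
    · simp only; omega

lemma exists_eq_lastSimplexOf {r : (X ⊗ Y : SSet.{u}) _⦋n⦌}
    (hr : r ∈ (X ⊗ Y : SSet.{u}).nonDegenerate n) (hc : IsCriticalPath (sPath r)) :
    ∃ (p q : ℕ) (h : p + q = n) (x : X.nonDegenerate p) (y : Y.nonDegenerate q),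
      lastSimplexOf h x.1 y.1 = r := by
  obtain ⟨h, hp⟩ := sPath_of_isCriticalPath hr hc
  refine ⟨_, _, h, degCore r.1, degCore r.2, Prod.ext ?_ ?_⟩
  · have e : prismLeft n (geomDim r.1) = degMap r.1 := by
      apply SimplexCategory.Hom.ext
      ext k : 2
      exact Fin.ext (congrArg Prod.fst (hp k)).symm
    change X.map (prismLeft n (geomDim r.1)).op _ = _
    rw [e, map_degMap]
  · have e : prismRight h = degMap r.2 := by
      apply SimplexCategory.Hom.ext
      ext k : 2
      exact Fin.ext (congrArg Prod.snd (hp k)).symm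
    change Y.map (prismRight h).op _ = _
    rw [e]
    exact map_degMap r.2

end Critical

/-! ### Critical cells as a basis of the small complex -/

section Kappa

variable (X Y : SSet.{u}) (n : ℕ)

/-- The pairs of non-degenerate simplices of complementary dimensions. -/
abbrev TensorIndex : Type u :=
  Σ pq : Finset.HasAntidiagonal.antidiagonal n, X.nonDegenerate pq.1.1 × Y.nonDegenerate pq.1.2

/-- The basis of the tensor product consisting of the generators `x ⊗ y`. -/
def tensorBasis : Module.Basis (TensorIndex X Y n) ℤ (TensorModule X Y n) :=
  DFinsupp.basis fun pq : Finset.HasAntidiagonal.antidiagonal n =>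
    (Finsupp.basisSingleOne (R := ℤ) (ι := X.nonDegenerate pq.1.1)).tensorProduct
      (Finsupp.basisSingleOne (R := ℤ) (ι := Y.nonDegenerate pq.1.2))

variable {X Y}

lemma tensorBasis_apply {p q : ℕ} (x : X.nonDegenerate p) (y : Y.nonDegenerate q) :
    tensorBasis X Y (p + q)
      ⟨⟨(p, q), Finset.HasAntidiagonal.mem_antidiagonal.2 rfl⟩, (x, y)⟩ = tensorGen x y := by
  rw [Module.Basis.apply_eq_iff, ← LinearEquiv.eq_symm_apply]
  change DirectSum.lof ℤ _ _ _ _ = (DFinsupp.mapRange.linearEquiv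
    fun pq : Finset.HasAntidiagonal.antidiagonal (p + q) =>
    ((Finsupp.basisSingleOne (R := ℤ) (ι := X.nonDegenerate pq.1.1)).tensorProduct
      (Finsupp.basisSingleOne (R := ℤ) (ι := Y.nonDegenerate pq.1.2))).repr.symm)
    (sigmaFinsuppEquivDFinsupp (Finsupp.single _ 1))
  rw [sigmaFinsuppEquivDFinsupp_single]
  refine Eq.trans ?_ (DFinsupp.mapRange_single (hf := fun _ => map_zero _)).symm
  rw [Module.Basis.repr_symm_single_one, Module.Basis.tensorProduct_apply]
  simp only [Finsupp.coe_basisSingleOne]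
  rfl

variable {C : CellComplex.{u}}

/-- The basis of the chains supported by the cells with the property `P`. -/
def spanBasis {n : ℕ} (P : C.cell n → Prop) : Module.Basis {c // P c} ℤ (spanOf P) :=
  .ofRepr (Finsupp.supportedEquivFinsupp {c | P c})

lemma coe_spanBasis {n : ℕ} (P : C.cell n → Prop) (c : {c // P c}) :
    (spanBasis P c : C.cell n →₀ ℤ) = Finsupp.single c.1 1 :=
  Finsupp.supportedEquivFinsupp_symm_single _ _ _

variable {G : SimplicialObject GrpCat.{w}} {F B : SSet.{u}}
  (act : SimplicialAction G F) (τ : TwistingFunction G B) {n : ℕ}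

/-- The critical cell over a pair of non-degenerate simplices. -/
def criticalCell (a : TensorIndex F B n) :
    {c : (normalizedComplex (twistedProduct act τ)).cell n //
      IsCritical (twistedEZField act τ) c} :=
  ⟨retwist act τ ⟨_, lastSimplexOf_nonDegenerate
      (Finset.HasAntidiagonal.mem_antidiagonal.1 a.1.2) a.2.1 a.2.2⟩,
    (isCritical_twistedEZField_iff act τ _).2
      (isCriticalPath_lastSimplexOf (Finset.HasAntidiagonal.mem_antidiagonal.1 a.1.2) a.2.1 a.2.2)⟩

/-- The bidimension recovers `(p, q)` and uniqueness of canonical expressions recovers the two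
simplices. Conversely, the path of a critical cell depends only on its bidimension. -/
lemma criticalCell_bijective :
    Function.Bijective (criticalCell act τ : TensorIndex F B n → _) := by
  constructor
  · rintro ⟨⟨⟨p, q⟩, h⟩, x, y⟩ ⟨⟨⟨p', q'⟩, h'⟩, x', y'⟩ heq
    have h1 := Finset.HasAntidiagonal.mem_antidiagonal.1 h
    have h1' := Finset.HasAntidiagonal.mem_antidiagonal.1 h'
    dsimp only at x y x' y' h1 h1'
    have e : lastSimplexOf h1 x.1 y.1 = lastSimplexOf h1' x'.1 y'.1 :=
      congrArg (fun c => c.1.1) heq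
    have hpq : (p, q) = (p', q') := by
      rw [← bidim_lastSimplexOf h1 x y, e, bidim_lastSimplexOf h1' x' y']
    obtain ⟨rfl, rfl⟩ := Prod.mk.injEq .. ▸ hpq
    have := epi_prismLeft (show p ≤ n by omega)
    have := epi_prismRight h1
    obtain rfl : x = x' := F.unique_nonDegenerate_simplex _ (prismLeft n p) x rfl
      (prismLeft n p) x' (congrArg Prod.fst e)
    obtain rfl : y = y' := B.unique_nonDegenerate_simplex _ (prismRight h1) y rfl
      (prismRight h1) y' (congrArg Prod.snd e)
    rfl
  · rintro ⟨c, hc⟩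
    obtain ⟨p, q, h, x, y, e⟩ := exists_eq_lastSimplexOf (untwist act τ c).2
      ((isCritical_twistedEZField_iff act τ c).1 hc)
    exact ⟨⟨⟨(p, q), Finset.HasAntidiagonal.mem_antidiagonal.2 h⟩, (x, y)⟩,
      Subtype.ext (Subtype.ext e)⟩

variable (n) in
/-- The identification of the tensor product with the free module on the critical cells. -/
def criticalEquiv : TensorModule F B n ≃ₗ[ℤ]
    spanOf (fun c : (normalizedComplex (twistedProduct act τ)).cell n =>
      IsCritical (twistedEZField act τ) c) :=
  (tensorBasis F B n).equiv (spanBasis _) (Equiv.ofBijective _ (criticalCell_bijective act τ))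

lemma coe_criticalEquiv_tensorGen {p q : ℕ} (x : F.nonDegenerate p) (y : B.nonDegenerate q) :
    (criticalEquiv act τ (p + q) (tensorGen x y) :
        (normalizedComplex (twistedProduct act τ)).cell (p + q) →₀ ℤ) =
      simplexChain (twistedProduct act τ) (lastSimplex x.1 y.1) := by
  rw [← tensorBasis_apply, criticalEquiv, Module.Basis.equiv_apply, coe_spanBasis]
  -- In dimension `p + q`, `lastSimplexOf` and `lastSimplex` agree definitionally.
  exact (simplexChain_of_nonDegenerate (twistedProduct act τ) _).symm

end Kappa

end TwistedEZ

end

theorem mainTheorem4 {G : SimplicialObject GrpCat.{w}} {F B : SSet.{u}}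
    (act : SimplicialAction G F) (τ : TwistingFunction G B) :
    -- the vector field of `F × B` is a vector field on `F ×_τ B`, with the same status of the cells
    IsDiscreteVectorField (twistedEZField act τ) ∧
    (∀ n (c : (normalizedComplex (twistedProduct act τ)).cell n),
      (IsSource (twistedEZField act τ) c ↔ IsSourcePath (sPath (untwist act τ c).1)) ∧
      (IsTarget (twistedEZField act τ) c ↔ IsTargetPath (sPath (untwist act τ c).1)) ∧
      (IsCritical (twistedEZField act τ) c ↔ IsCriticalPath (sPath (untwist act τ c).1))) ∧
    -- it has a lexicographic Lyapunov function and is admissible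
    IsLyapunov (twistedEZField act τ) (fun n c => toLex ((bidim (untwist act τ c).1).2,
      toLex ((bidim (untwist act τ c).1).1, pointsAbove (untwist act τ c).1))) ∧
    IsAdmissible (twistedEZField act τ) ∧
    -- the reduction which it defines
    ∃ (d : ∀ n, TensorModule F B (n + 1) →ₗ[ℤ] TensorModule F B n)
      (hd : ∀ n, d n ∘ₗ d (n + 1) = 0)
      (ρ : Reduction (normalizedComplex (twistedProduct act τ)).chain (twistedTensor F B d hd))
      (κ : ∀ n, TensorModule F B n ≃ₗ[ℤ]
        spanOf (fun c : (normalizedComplex (twistedProduct act τ)).cell n =>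
          IsCritical (twistedEZField act τ) c)),
      (∀ p q (x : F.nonDegenerate p) (y : B.nonDegenerate q),
        (κ (p + q) (tensorGen x y) :
            (normalizedComplex (twistedProduct act τ)).cell (p + q) →₀ ℤ) =
          simplexChain (twistedProduct act τ) (lastSimplex x.1 y.1)) ∧
      IsInducedBy ρ (twistedEZField act τ) κ := by
  have hV := twistedEZField_isDiscreteVectorField act τ
  have hL := twistedEZField_isLyapunov act τ
  -- The lexicographic order on triples of natural numbers is well-founded; this yields both
  -- admissibility and the recursion defining `h`.
  have hwf := hL.wellFounded_pathRel
  refine ⟨hV, fun n c => ⟨isSource_twistedEZField_iff act τ c, isTarget_twistedEZField_iff act τ c,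
    isCritical_twistedEZField_iff act τ c⟩, hL, hV.isAdmissible hwf, ?_⟩
  obtain ⟨d, hd, ρ, hρ⟩ := exists_reduction_isInducedBy (M := TensorModule F B) hV hwf
    (fun n => criticalEquiv act τ n)
  exact ⟨d, hd, ρ, fun n => criticalEquiv act τ n,
    fun _ _ x y => coe_criticalEquiv_tensorGen act τ x y, hρ⟩
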